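/- Let $\mathbb F$ be a field of characteristic $0$. Let $X$ be a connected finite simplicial complex, whose simplices are nonempty and determined by their vertex sets; its geometric realization is also denoted $X$. Let $\delta:\mathbb Z_{\ge 0}\to\mathbb Z$ be a perversity: $\delta(0)=0$ and for every $k\ge 0$ the function $\delta$ maps $\{0,\dots,k\}$ bijectively onto $\{a,a+1,\dots,a+k\}$ for some integer $a\le 0$. For a simplex $\Delta$ put $\delta(\Delta)=\delta(\dim\Delta)$, and write $\Delta\leftrightarrow\Delta'$ (incident) if one of $\Delta,\Delta'$ is a face of the other. *Constructible sheaves.* The open simplices of the first barycentric subdivision $\hat X$ are the open simplices $\hat\Delta$ spanned by the barycenters of nonempty sets of pairwise incident simplices of $X$. The $(-\delta)$-perverse simplex ${}^{-\delta}\!\Delta\subseteq X$ of a simplex $\Delta$ is the union of those $\hat\Delta$ which have the barycenter of $\Delta$ as a vertex and such that $-\delta(\Delta')\le-\delta(\Delta)$ for every simplex $\Delta'$ of $X$ whose barycenter is a vertex of $\hat\Delta$. Let $\mathfrak{Sh}_c(X,\delta)$ be the full subcategory of sheaves $\mathbf A$ of $\mathbb F$-vector spaces on $X$ such that, for every simplex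 $\Delta$, the inverse image of $\mathbf A$ on ${}^{-\delta}\!\Delta$ is isomorphic to the constant sheaf of a finite-dimensional vector space. *Modules and linear algebra data.* Let $Q$ be the quiver whose vertices are the simplices of $X$, with exactly one arrow $\Delta\to\Delta'$ if $\delta(\Delta)=\delta(\Delta')+1$ and $\Delta\leftrightarrow\Delta'$, and no other arrows. Let $B(X,\delta)$ be the quotient of the path algebra $\mathbb FQ$ (products written like compositions, from right to left) by the relations $b(\Delta_1,\Delta'')\,b(\Delta',\Delta_1)=b(\Delta_2,\Delta'')\,b(\Delta',\Delta_2)$ for all arrows $\Delta'\to\Delta_1\to\Delta''$ and $\Delta'\to\Delta_2\to\Delta''$, where $b(\Delta,\Delta')$ is the class of the arrow $\Delta\to\Delta'$; let $e_\Delta$ be the class of the trivial path at $\Delta$. Let $\mathcal R(X,\delta)$ be the category of finite-dimensional left $B(X,\delta)$-modules. By linear algebra data we mean a vector space $S(\Delta)$ for every simplex $\Delta$ and a linear map $s(\Delta,\Delta'):S(\Delta)\to S(\Delta')$ for every arrow $\Delta\to\Delta'$, such that $s(\Delta_1,\Delta'')\circ s(\Delta',\Delta_1)=s(\Delta_2,\Delta'')\circ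 s(\Delta',\Delta_2)$ for all arrows as above (the equivalence axiom); morphisms are families of linear maps commuting with the maps $s$. Then: 1. The categories $\mathcal R(X,\delta)$ and $\mathfrak{Sh}_c(X,\delta)$ are canonically equivalent. Precisely, let $U_\Delta$ be the open set that is the union of the ${}^{-\delta}\!\Delta'$ over all $\Delta'$ which can be reached from $\Delta$ by a (possibly trivial) path in $Q$. There is an equivalence $E:\mathcal R(X,\delta)\to\mathfrak{Sh}_c(X,\delta)$ such that, naturally in $M$, the linear algebra data $\Delta\mapsto\Gamma(U_\Delta,E(M))$ with the restriction maps of the sheaf $E(M)$ are isomorphic to the linear algebra data $\Delta\mapsto e_\Delta M$ with the multiplications by $b(\Delta,\Delta')$. 2. The functor $M\mapsto\bigl((e_\Delta M)_\Delta,\ \text{multiplication by } b(\Delta,\Delta')\bigr)$ is an equivalence from $\mathcal R(X,\delta)$ to the category of linear algebra data with all $S(\Delta)$ finite-dimensional. -/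

import Mathlib

universe u

open CategoryTheory TopologicalSpace Opposite

/-! ### Perversities -/

/-- A perversity: `δ 0 = 0`, and `δ` maps every interval `{0, …, k}` bijectively onto an interval
`{a, …, a + k}` of integers with `a ≤ 0`. -/
def IsPerversity (δ : ℕ → ℤ) : Prop :=
  δ 0 = 0 ∧ ∀ k : ℕ, ∃ a : ℤ, a ≤ 0 ∧ Set.BijOn δ (Set.Icc 0 k) (Set.Icc a (a + k))

namespace AbstractSimplicialComplex

noncomputable section

/-! ### Simplices, realization, barycentric subdivision, perverse simplices -/

section Geometry

variable {V : Type u} [Fintype V] (K : AbstractSimplicialComplex V)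

/-- The (nonempty) simplices of `K`. -/
abbrev Simplex : Type u := {s : Finset V // s ∈ K.faces}

instance : Fintype K.Simplex := Fintype.ofFinite _

/-- The geometric realization in barycentric coordinates, with the topology induced from `ℝ^V`. -/
def realization : Set (V → ℝ) :=
  {x | (∀ v, 0 ≤ x v) ∧ ∑ v, x v = 1 ∧ ∃ s ∈ K.faces, (s : Set V) = Function.support x}

/-- The realization of `K` as a topological space. -/
abbrev space : TopCat.{u} := TopCat.of K.realization

variable {K}

/-- The dimension of a simplex. -/
def Simplex.dim (Δ : K.Simplex) : ℕ := Δ.1.card - 1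

/-- The barycenter of a simplex. -/
def Simplex.barycenter (Δ : K.Simplex) : V → ℝ :=
  Set.indicator (Δ.1 : Set V) fun _ ↦ (Δ.1.card : ℝ)⁻¹

/-- Two simplices are incident if one is a face of the other. -/
def Simplex.Incident (Δ Δ' : K.Simplex) : Prop := Δ.1 ⊆ Δ'.1 ∨ Δ'.1 ⊆ Δ.1

variable (K)

/-- The simplices of the first barycentric subdivision: nonempty sets of (barycenters of)
pairwise incident simplices of `K`. -/
def IsFlag (c : Finset K.Simplex) : Prop :=
  c.Nonempty ∧ ∀ Δ ∈ c, ∀ Δ' ∈ c, Δ.Incident Δ'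

/-- The open simplex spanned by the barycenters of the members of `c`. -/
def openSubdivisionSimplex (c : Finset K.Simplex) : Set K.space :=
  {x | ∃ w : K.Simplex → ℝ, (∀ Δ ∈ c, 0 < w Δ) ∧ ∑ Δ ∈ c, w Δ = 1 ∧
    x.1 = ∑ Δ ∈ c, w Δ • Δ.barycenter}

/-- The `ε`-perverse simplex of `Δ`: the union of all open simplices of the barycentric subdivision
among whose vertices the barycenter of `Δ` is the one with the largest value of `ε`. -/
def perverseSimplex (ε : ℕ → ℤ) (Δ : K.Simplex) : Set K.space :=
  ⋃ c ∈ {c : Finset K.Simplex | K.IsFlag c ∧ Δ ∈ c ∧ ∀ Δ' ∈ c, ε Δ'.dim ≤ ε Δ.dim},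
    K.openSubdivisionSimplex c

/-- The inclusion of a perverse simplex into the realization. -/
def perverseInclusion (ε : ℕ → ℤ) (Δ : K.Simplex) :
    TopCat.of (K.perverseSimplex ε Δ) ⟶ K.space :=
  TopCat.ofHom ⟨Subtype.val, continuous_subtype_val⟩

end Geometry

/-! ### Constructible sheaves -/

section Sheaves

variable (F : Type u) [Field F] {V : Type u} [Fintype V] (K : AbstractSimplicialComplex V)

/-- A sheaf of `F`-vector spaces is constructible with respect to the `ε`-perverse triangulation
if its inverse image on every `ε`-perverse simplex is isomorphic to the constant sheaf of a
finite-dimensional vector space. -/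
def IsPerverselyConstructible (ε : ℕ → ℤ) :
    ObjectProperty (TopCat.Sheaf (ModuleCat.{u} F) K.space) := fun A ↦
  ∀ Δ : K.Simplex, ∃ W : ModuleCat.{u} F, Module.Finite F W ∧
    Nonempty ((TopCat.Sheaf.pullback (ModuleCat.{u} F) (K.perverseInclusion ε Δ)).obj A ≅
      (constantSheaf (Opens.grothendieckTopology (TopCat.of (K.perverseSimplex ε Δ)))
        (ModuleCat.{u} F)).obj W)

/-- The category of `δ`-sheaves: sheaves on `|K|` that are constructible with respect to the
`(-δ)`-perverse triangulation. -/
abbrev DeltaSheaf (δ : ℕ → ℤ) : Type (u + 1) :=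
  (K.IsPerverselyConstructible F (fun k ↦ -δ k)).FullSubcategory

end Sheaves

/-! ### The quiver, its algebra, and the quotient by the equivalence relations -/

section Algebra

variable (F : Type u) [Field F] {V : Type u} [Fintype V] (K : AbstractSimplicialComplex V)
  (δ : ℕ → ℤ)

/-- There is an arrow `Δ ⟶ Δ'` iff `δ(Δ) = δ(Δ') + 1` and `Δ`, `Δ'` are incident. -/
def HasArrow (Δ Δ' : K.Simplex) : Prop := δ Δ.dim = δ Δ'.dim + 1 ∧ Δ.Incident Δ'

/-- The arrows of the quiver, as pairs (source, target). -/
abbrev Arrow : Type u := {p : K.Simplex × K.Simplex // K.HasArrow δ p.1 p.2}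

/-- The free algebra on the vertices and the arrows of the quiver. -/
abbrev FreeQuiverAlgebra : Type u := FreeAlgebra F (K.Simplex ⊕ K.Arrow δ)

/-- The relations of the path algebra: the trivial paths are orthogonal idempotents with sum `1`,
and they act as left (right) identities on arrows ending (starting) at the vertex.
Products are written from right to left, like composition of maps. -/
inductive PathRel : FreeQuiverAlgebra F K δ → FreeQuiverAlgebra F K δ → Prop
  | idem (Δ : K.Simplex) :
      PathRel (FreeAlgebra.ι F (Sum.inl Δ) * FreeAlgebra.ι F (Sum.inl Δ))
        (FreeAlgebra.ι F (Sum.inl Δ))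
  | orth (Δ Δ' : K.Simplex) (h : Δ ≠ Δ') :
      PathRel (FreeAlgebra.ι F (Sum.inl Δ) * FreeAlgebra.ι F (Sum.inl Δ')) 0
  | one : PathRel (∑ Δ : K.Simplex, FreeAlgebra.ι F (Sum.inl Δ)) 1
  | target (a : K.Arrow δ) :
      PathRel (FreeAlgebra.ι F (Sum.inl a.1.2) * FreeAlgebra.ι F (Sum.inr a))
        (FreeAlgebra.ι F (Sum.inr a))
  | source (a : K.Arrow δ) :
      PathRel (FreeAlgebra.ι F (Sum.inr a) * FreeAlgebra.ι F (Sum.inl a.1.1))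
        (FreeAlgebra.ι F (Sum.inr a))

/-- The quiver (path) algebra, presented by trivial paths and arrows. -/
abbrev QuiverAlgebra : Type u := RingQuot (PathRel F K δ)

/-- The arrow `Δ ⟶ Δ'` as an element of the quiver algebra. -/
def arrowElt {Δ Δ' : K.Simplex} (h : K.HasArrow δ Δ Δ') : QuiverAlgebra F K δ :=
  RingQuot.mkAlgHom F (PathRel F K δ) (FreeAlgebra.ι F (Sum.inr ⟨(Δ, Δ'), h⟩))

/-- The equivalence relations: any two paths of length two with the same source and the same target
are identified. -/
inductive EquivalenceRel : QuiverAlgebra F K δ → QuiverAlgebra F K δ → Prop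
  | mk {Δ' Δ₁ Δ₂ Δ'' : K.Simplex} (h₁ : K.HasArrow δ Δ' Δ₁) (h₁' : K.HasArrow δ Δ₁ Δ'')
      (h₂ : K.HasArrow δ Δ' Δ₂) (h₂' : K.HasArrow δ Δ₂ Δ'') :
      EquivalenceRel (arrowElt F K δ h₁' * arrowElt F K δ h₁)
        (arrowElt F K δ h₂' * arrowElt F K δ h₂)

/-- The algebra `B(K, δ)`. -/
abbrev AlgebraB : Type u := RingQuot (EquivalenceRel F K δ)

/-- The idempotent `e_Δ` of `B(K, δ)`. -/
def idemB (Δ : K.Simplex) : AlgebraB F K δ :=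
  RingQuot.mkAlgHom F (EquivalenceRel F K δ)
    (RingQuot.mkAlgHom F (PathRel F K δ) (FreeAlgebra.ι F (Sum.inl Δ)))

/-- The generator `b(Δ, Δ')` of `B(K, δ)`. -/
def genB {Δ Δ' : K.Simplex} (h : K.HasArrow δ Δ Δ') : AlgebraB F K δ :=
  RingQuot.mkAlgHom F (EquivalenceRel F K δ) (arrowElt F K δ h)

lemma idemB_mul_genB {Δ Δ' : K.Simplex} (h : K.HasArrow δ Δ Δ') :
    idemB F K δ Δ' * genB F K δ h = genB F K δ h := by
  unfold idemB genB arrowElt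
  rw [← map_mul, ← map_mul, RingQuot.mkAlgHom_rel F (PathRel.target ⟨(Δ, Δ'), h⟩)]

lemma genB_mul_genB {Δ' Δ₁ Δ₂ Δ'' : K.Simplex} (h₁ : K.HasArrow δ Δ' Δ₁)
    (h₁' : K.HasArrow δ Δ₁ Δ'') (h₂ : K.HasArrow δ Δ' Δ₂) (h₂' : K.HasArrow δ Δ₂ Δ'') :
    genB F K δ h₁' * genB F K δ h₁ = genB F K δ h₂' * genB F K δ h₂ := by
  unfold genB
  rw [← map_mul, ← map_mul, RingQuot.mkAlgHom_rel F (EquivalenceRel.mk h₁ h₁' h₂ h₂')]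

open scoped ModuleCat in
/-- Left `B(K, δ)`-modules that are finite-dimensional over `F`. -/
def IsFiniteDimensionalModule : ObjectProperty (ModuleCat.{u} (AlgebraB F K δ)) := fun M ↦
  Module.Finite F M

/-- The category `R(K, δ)` of finite-dimensional left `B(K, δ)`-modules. -/
abbrev CategoryR : Type (u + 1) := (IsFiniteDimensionalModule F K δ).FullSubcategory

end Algebra

/-! ### Linear algebra data subject to the equivalence axiom -/

section LinearData

variable (F : Type u) [Field F] {V : Type u} [Fintype V] (K : AbstractSimplicialComplex V)
  (δ : ℕ → ℤ)

/-- Linear algebra data: a vector space for each simplex, a restriction map for each arrow, and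
the equivalence axiom. No finiteness is imposed here, see `FinLinearData`. -/
structure LinearData where
  /-- the stalk at a simplex -/
  stalk : K.Simplex → ModuleCat.{u} F
  /-- the restriction maps -/
  res : ∀ {Δ Δ' : K.Simplex}, K.HasArrow δ Δ Δ' → (stalk Δ ⟶ stalk Δ')
  /-- the equivalence axiom -/
  equivalence : ∀ {Δ' Δ₁ Δ₂ Δ'' : K.Simplex} (h₁ : K.HasArrow δ Δ' Δ₁)
    (h₁' : K.HasArrow δ Δ₁ Δ'') (h₂ : K.HasArrow δ Δ' Δ₂) (h₂' : K.HasArrow δ Δ₂ Δ''),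
    res h₁ ≫ res h₁' = res h₂ ≫ res h₂'

variable {F K δ} in
/-- Morphisms: stalkwise linear maps commuting with the restriction maps. -/
@[ext]
structure LinearData.Hom (S T : LinearData F K δ) where
  /-- the map on stalks -/
  app : ∀ Δ : K.Simplex, S.stalk Δ ⟶ T.stalk Δ
  comm : ∀ {Δ Δ' : K.Simplex} (h : K.HasArrow δ Δ Δ'), S.res h ≫ app Δ' = app Δ ≫ T.res h

instance : Category (LinearData F K δ) where
  Hom := LinearData.Hom
  id S := { app := fun _ ↦ 𝟙 _, comm := fun h ↦ by simp }
  comp f g :=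
    { app := fun Δ ↦ f.app Δ ≫ g.app Δ
      comm := fun h ↦ by
        rw [← Category.assoc, f.comm h, Category.assoc, g.comm h, Category.assoc] }
  id_comp f := LinearData.Hom.ext (funext fun _ ↦ Category.id_comp _)
  comp_id f := LinearData.Hom.ext (funext fun _ ↦ Category.comp_id _)
  assoc f g h := LinearData.Hom.ext (funext fun _ ↦ Category.assoc _ _ _)

/-- All stalks are finite-dimensional. -/
def IsFiniteDimensionalData : ObjectProperty (LinearData F K δ) := fun S ↦
  ∀ Δ : K.Simplex, Module.Finite F (S.stalk Δ)

/-- Linear algebra data with finite-dimensional stalks. -/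
abbrev FinLinearData : Type (u + 1) := (IsFiniteDimensionalData F K δ).FullSubcategory

end LinearData

/-! ### The comparison functors -/

section Comparison

variable (F : Type u) [Field F] {V : Type u} [Fintype V] (K : AbstractSimplicialComplex V)
  (δ : ℕ → ℤ)

open scoped ModuleCat

variable {F K δ} in
/-- The action of an element of `B(K, δ)` on a module, as an `F`-linear map. -/
def act (M : ModuleCat.{u} (AlgebraB F K δ)) (b : AlgebraB F K δ) : M →ₗ[F] M :=
  Algebra.lsmul F F M b

lemma act_mul (M : ModuleCat.{u} (AlgebraB F K δ)) (a b : AlgebraB F K δ) (m : M) :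
    act M (a * b) m = act M a (act M b m) :=
  mul_smul a b m

variable {F K δ} in
/-- The subspace `e_Δ M` of a module `M`. -/
def stalkSubmodule (M : ModuleCat.{u} (AlgebraB F K δ)) (Δ : K.Simplex) : Submodule F M :=
  LinearMap.range (act M (idemB F K δ Δ))

lemma act_genB_mem (M : ModuleCat.{u} (AlgebraB F K δ)) {Δ Δ' : K.Simplex}
    (h : K.HasArrow δ Δ Δ') (m : M) : act M (genB F K δ h) m ∈ stalkSubmodule M Δ' :=
  ⟨act M (genB F K δ h) m, by rw [← act_mul, idemB_mul_genB]⟩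

lemma map_act {M N : ModuleCat.{u} (AlgebraB F K δ)} (f : M ⟶ N) (b : AlgebraB F K δ) (m : M) :
    f.hom (act M b m) = act N b (f.hom m) :=
  f.hom.map_smul b m

variable {F K δ} in
/-- Multiplication by `b(Δ, Δ')`, as a map `e_Δ M → e_Δ' M`. -/
def stalkRes (M : ModuleCat.{u} (AlgebraB F K δ)) {Δ Δ' : K.Simplex} (h : K.HasArrow δ Δ Δ') :
    stalkSubmodule M Δ →ₗ[F] stalkSubmodule M Δ' :=
  (act M (genB F K δ h)).restrict fun m _ ↦ act_genB_mem F K δ M h m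

variable {F K δ} in
/-- The restriction of a module homomorphism `M → N` to a map `e_Δ M → e_Δ N`. -/
def stalkMap {M N : ModuleCat.{u} (AlgebraB F K δ)} (f : M ⟶ N) (Δ : K.Simplex) :
    stalkSubmodule M Δ →ₗ[F] stalkSubmodule N Δ :=
  (f.hom.restrictScalars F).restrict <| by
    rintro _ ⟨m, rfl⟩
    exact ⟨f.hom m, (map_act F K δ f _ m).symm⟩

/-- The linear algebra data of a module `M`: the stalk at `Δ` is `e_Δ M`, and the restriction map
of the arrow `Δ ⟶ Δ'` is multiplication by `b(Δ, Δ')`. -/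
def moduleData : ModuleCat.{u} (AlgebraB F K δ) ⥤ LinearData F K δ where
  obj M :=
    { stalk := fun Δ ↦ ModuleCat.of F (stalkSubmodule M Δ)
      res := fun h ↦ ModuleCat.ofHom (stalkRes M h)
      equivalence := fun h₁ h₁' h₂ h₂' ↦ ModuleCat.hom_ext <| LinearMap.ext fun m ↦
        Subtype.ext <| by
          change act M _ (act M _ m.1) = act M _ (act M _ m.1)
          rw [← act_mul, ← act_mul, genB_mul_genB F K δ h₁ h₁' h₂ h₂'] }
  map {M N} f :=
    { app := fun Δ ↦ ModuleCat.ofHom (stalkMap f Δ)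
      comm := fun h ↦ ModuleCat.hom_ext <| LinearMap.ext fun m ↦
        Subtype.ext <| map_act F K δ f _ m.1 }
  map_id M := LinearData.Hom.ext <| funext fun Δ ↦ ModuleCat.hom_ext <| LinearMap.ext fun m ↦ rfl
  map_comp f g := LinearData.Hom.ext <| funext fun Δ ↦ ModuleCat.hom_ext <|
    LinearMap.ext fun m ↦ rfl

/-- The partial order generated by the arrows: `Δ ≤ Δ'` iff there is a path from `Δ` to `Δ'`. -/
def PathLE (Δ Δ' : K.Simplex) : Prop := Relation.ReflTransGen (K.HasArrow δ) Δ Δ'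

/-- The perverse open star of `Δ`: the union of the `(-δ)`-perverse simplices of all `Δ' ≥ Δ`.
For a perversity `δ` this union is open, so it equals its interior; the interior is taken so that
the definition makes sense for every function `δ`. -/
def perverseStar (Δ : K.Simplex) : Opens K.space :=
  ⟨interior (⋃ Δ' ∈ {Δ' | K.PathLE δ Δ Δ'}, K.perverseSimplex (fun k ↦ -δ k) Δ'), isOpen_interior⟩

lemma perverseStar_le {Δ Δ' : K.Simplex} (h : K.HasArrow δ Δ Δ') :
    K.perverseStar δ Δ' ≤ K.perverseStar δ Δ :=
  interior_mono <| Set.biUnion_mono (fun _ h' ↦ Relation.ReflTransGen.head h h') fun _ _ ↦ le_rfl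

/-- The linear algebra data of a sheaf `A`: the stalk at `Δ` is the space of sections of `A` over
the perverse open star of `Δ`, and the restriction maps are those of `A`. -/
def sheafData : TopCat.Sheaf (ModuleCat.{u} F) K.space ⥤ LinearData F K δ where
  obj A :=
    { stalk := fun Δ ↦ A.presheaf.obj (op (K.perverseStar δ Δ))
      res := fun h ↦ A.presheaf.map (homOfLE (K.perverseStar_le δ h)).op
      equivalence := fun _ _ _ _ ↦ by
        rw [← Functor.map_comp, ← Functor.map_comp]
        rfl }
  map f :=
    { app := fun Δ ↦ f.hom.app (op (K.perverseStar δ Δ))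
      comm := fun h ↦ f.hom.naturality _ }
  map_id A := rfl
  map_comp f g := rfl

end Comparison

end

end AbstractSimplicialComplex

/-!
A point of `|K|` lies in the stratum of the simplex of least `δ` in its barycentric carrier. By the
perversity condition any two paths of `Q` with the same ends are related by exchanges of single
vertices, so that by the equivalence axiom linear algebra data are the same as functors on the order
of the simplices by paths. The sheaf of such data consists of the families of elements, one at each
point, that are locally compatible with the maps along paths. Its sections on a perverse star are
determined by their values at the barycenter, because every stratum is contracted to its barycenter
along segments.

Conversely, the stalks of a constructible sheaf are constant along the strata, and extending
sections along a segment that joins the strata of two incident simplices gives a map between their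
stalks that depends neither on the segment nor on a subdivision of it. These maps are linear algebra
data whose sheaf is the given one.
-/

noncomputable section

namespace PerverseSheaves

open Topology TopCat TopCat.Presheaf

/-! ### Sheaves of families cut out by a local linear condition -/

section LocalSections

variable {R : Type u} [Ring R] {X : TopCat.{u}} (M : X → ModuleCat.{u} R)
  (C : ∀ x y, Submodule R (M x × M y))

/-- The families `s x ∈ M x`, `x ∈ U`, such that for every `x` the relation `C x y` holds between
`s x` and `s y` for all `y` near `x`. -/
def localSectionsSubmodule (U : Opens X) : Submodule R (∀ x : U, M x) where
  carrier := {s | ∀ x : U, ∀ᶠ y in 𝓝 x.1, ∀ hy : y ∈ U, (s x, s ⟨y, hy⟩) ∈ C x y}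
  zero_mem' := fun x ↦ .of_forall fun y _ ↦ (C x y).zero_mem
  add_mem' := fun hs ht x ↦ by
    filter_upwards [hs x, ht x] with y h h' hy using (C x y).add_mem (h hy) (h' hy)
  smul_mem' := fun a s hs x ↦ by
    filter_upwards [hs x] with y h hy using (C x y).smul_mem a (h hy)

/-- The condition defining `localSectionsSubmodule`, as a local predicate. -/
def localSectionsPredicate : LocalPredicate fun x : X ↦ M x where
  pred {U} s := s ∈ localSectionsSubmodule M C U
  res i s hs x := by
    filter_upwards [hs (i x)] with y h hy using h (i.le hy)
  locality {U} s hs x := by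
    obtain ⟨V, hxV, i, hsV⟩ := hs x
    filter_upwards [V.2.mem_nhds hxV, hsV ⟨x, hxV⟩] with y hyV h _ using h hyV

/-- The presheaf of the families in `localSectionsSubmodule`. -/
def localSectionsPresheaf : X.Presheaf (ModuleCat.{u} R) where
  obj U := ModuleCat.of R (localSectionsSubmodule M C U.unop)
  map i := ModuleCat.ofHom
    { toFun := fun s ↦ ⟨fun x ↦ s.1 (i.unop x), (localSectionsPredicate M C).res i.unop s.1 s.2⟩
      map_add' := fun _ _ ↦ rfl
      map_smul' := fun _ _ ↦ rfl }

/-- The sheaf of the families `s x ∈ M x` such that `C x y` relates `s x` and `s y` for all `y`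
near `x`. -/
def localSections : TopCat.Sheaf (ModuleCat.{u} R) X :=
  ⟨localSectionsPresheaf M C, (isSheaf_iff_isSheaf_comp (forget (ModuleCat.{u} R)) _).mpr
    (subpresheafToTypes.isSheaf (localSectionsPredicate M C))⟩

/-- The value of a germ of a local section at the base point. -/
def stalkEval (x : X) : (localSections M C).presheaf.stalk x ⟶ M x :=
  Limits.colimit.desc _
    { pt := M x
      ι :=
        { app := fun U ↦ ModuleCat.ofHom
            ((LinearMap.proj (⟨x, U.unop.2⟩ : U.unop.1)).comp (Submodule.subtype _))
          naturality := fun _ _ _ ↦ rfl } }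

variable {M C}

lemma stalkEval_germ {x : X} {U : Opens X} (hx : x ∈ U)
    (s : (localSections M C).presheaf.obj (op U)) :
    stalkEval M C x ((localSections M C).presheaf.germ U x hx s) = s.1 ⟨x, hx⟩ := by
  have : (localSections M C).presheaf.germ U x hx ≫ stalkEval M C x = ModuleCat.ofHom
      ((LinearMap.proj (⟨x, hx⟩ : U)).comp (Submodule.subtype _)) :=
    Limits.colimit.ι_desc _ _
  exact congr($this s)

lemma stalkEval_injective {x : X} (hC : ∀ᶠ y in 𝓝 x, ∀ b, ((0 : M x), b) ∈ C x y → b = 0) :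
    Function.Injective (stalkEval M C x) := by
  rw [injective_iff_map_eq_zero]
  intro a ha
  obtain ⟨U, hx, s, rfl⟩ := (localSections M C).presheaf.exists_germ_eq a
  rw [stalkEval_germ] at ha
  have hs : ∀ᶠ y in 𝓝 x, ∀ hy : y ∈ U, s.1 ⟨y, hy⟩ = 0 := by
    filter_upwards [s.2 ⟨x, hx⟩, hC] with y hy hCy hyU
    exact hCy _ (ha ▸ hy hyU)
  obtain ⟨W, hW, hWo, hxW⟩ := eventually_nhds_iff.mp hs
  let W' : Opens X := ⟨W, hWo⟩ ⊓ U
  have hres : (localSections M C).presheaf.map (homOfLE (inf_le_right : W' ≤ U)).op s = 0 :=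
    Subtype.ext (funext fun y ↦ hW y.1 y.2.1 y.2.2)
  rw [← germ_res_apply _ (homOfLE (inf_le_right : W' ≤ U)) x ⟨hxW, hx⟩ s, hres, map_zero]

lemma stalkEval_surjective {x : X} (hM : ∀ m : M x, ∃ (U : Opens X) (hx : x ∈ U)
    (s : localSectionsSubmodule M C U), s.1 ⟨x, hx⟩ = m) :
    Function.Surjective (stalkEval M C x) := by
  intro m
  obtain ⟨U, hx, s, rfl⟩ := hM m
  exact ⟨(localSections M C).presheaf.germ U x hx s, stalkEval_germ hx s⟩

end LocalSections

/-! ### Inverse images -/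

section InverseImage

variable {R : Type u} [Ring R] {X Z : TopCat.{u}} {i : Z ⟶ X}

/-- The map on stalks induced by a morphism of presheaves: `stalkFunctor` on morphisms, with the
stalks as source and target. -/
def stalkHom {P Q : X.Presheaf (ModuleCat.{u} R)} (f : P ⟶ Q) (x : X) : P.stalk x ⟶ Q.stalk x :=
  (stalkFunctor _ x).map f

lemma stalkHom_comp {P Q S : X.Presheaf (ModuleCat.{u} R)} (f : P ⟶ Q) (g : Q ⟶ S) (x : X) :
    stalkHom (f ≫ g) x = stalkHom f x ≫ stalkHom g x :=
  Functor.map_comp _ f g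

lemma germ_stalkHom {P Q : X.Presheaf (ModuleCat.{u} R)} (f : P ⟶ Q) {U : Opens X} {x : X}
    (hx : x ∈ U) : P.germ U x hx ≫ stalkHom f x = f.app (op U) ≫ Q.germ U x hx :=
  stalkFunctor_map_germ U x hx f

instance (P : X.Presheaf (ModuleCat.{u} R)) (x : X) :
    IsIso (stalkHom (toSheafify (Opens.grothendieckTopology X) P) x) :=
  stalkFunctor_map_unit_toSheafify_isIso x _ P

lemma nonempty_sheafification_iso {P : X.Presheaf (ModuleCat.{u} R)}
    {B : TopCat.Sheaf (ModuleCat.{u} R) X} (f : P ⟶ B.presheaf) (hf : ∀ x, IsIso (stalkHom f x)) :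
    Nonempty ((presheafToSheaf (Opens.grothendieckTopology X) _).obj P ≅ B) := by
  let g : (presheafToSheaf (Opens.grothendieckTopology X) _).obj P ⟶ B :=
    ((sheafificationAdjunction _ _).homEquiv P B).symm f
  have hfg : toSheafify (Opens.grothendieckTopology X) P ≫ g.hom = f :=
    ((sheafificationAdjunction _ _).homEquiv P B).apply_symm_apply f
  have hgx : ∀ x, IsIso (stalkHom g.hom x) := fun x ↦ by
    have hfx := hf x
    rw [← hfg, stalkHom_comp] at hfx
    exact IsIso.of_isIso_comp_left (stalkHom (toSheafify _ P) x) _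
  have hg : IsIso g := (isIso_iff_stalkFunctor_map_iso g).mpr hgx
  exact ⟨asIso g⟩

/-- The map on stalks `A_{i z} ⟶ B_z` induced by a morphism `β` from `A` to the direct image of `B`
under `i`. -/
def stalkComparison {A : X.Presheaf (ModuleCat.{u} R)} {B : Z.Presheaf (ModuleCat.{u} R)}
    (β : A ⟶ (pushforward _ i).obj B) (z : Z) : A.stalk (i z) ⟶ B.stalk z :=
  stalkHom β (i z) ≫ B.stalkPushforward _ i z

lemma germ_stalkComparison {A : X.Presheaf (ModuleCat.{u} R)} {B : Z.Presheaf (ModuleCat.{u} R)}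
    (β : A ⟶ (pushforward _ i).obj B) {U : Opens X} {z : Z} (hz : i z ∈ U) :
    A.germ U (i z) hz ≫ stalkComparison β z =
      β.app (op U) ≫ B.germ ((Opens.map i).obj U) z hz := by
  rw [stalkComparison, ← Category.assoc, germ_stalkHom, Category.assoc, stalkPushforward_germ]

lemma stalkComparison_homEquiv {A : X.Presheaf (ModuleCat.{u} R)}
    {B : Z.Presheaf (ModuleCat.{u} R)} (f : (Presheaf.pullback _ i).obj A ⟶ B) (z : Z) :
    stalkComparison ((pullbackPushforwardAdjunction _ i).homEquiv A B f) z =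
      (stalkPullbackIso _ i A z).hom ≫ stalkHom f z := by
  refine stalk_hom_ext A fun U hz ↦ ?_
  rw [germ_stalkComparison, Adjunction.homEquiv_unit]
  refine .trans ?_ (congr($(germ_stalkPullbackHom _ i A z U hz) ≫ stalkHom f z)).symm
  rw [Category.assoc]
  exact (Category.assoc _ _ _).trans congr(((pullbackPushforwardAdjunction _ i).unit.app A).app
    (op U) ≫ $((germ_stalkHom f (U := (Opens.map i).obj U) (x := z) hz).symm))

lemma nonempty_pullback_iso_iff (A : TopCat.Sheaf (ModuleCat.{u} R) X)
    (B : TopCat.Sheaf (ModuleCat.{u} R) Z) :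
    Nonempty ((TopCat.Sheaf.pullback (ModuleCat.{u} R) i).obj A ≅ B) ↔
      ∃ β : A.presheaf ⟶ (pushforward _ i).obj B.presheaf, ∀ z, IsIso (stalkComparison β z) := by
  let P := (Presheaf.pullback (ModuleCat.{u} R) i).obj A.presheaf
  let e : (TopCat.Sheaf.pullback (ModuleCat.{u} R) i).obj A ≅
      (presheafToSheaf (Opens.grothendieckTopology Z) _).obj P :=
    (TopCat.Sheaf.pullbackIso (ModuleCat.{u} R) i).app A
  constructor
  · rintro ⟨φ⟩
    let ψ := e.symm ≪≫ φ
    refine ⟨(pullbackPushforwardAdjunction _ i).homEquiv _ _ (toSheafify _ P ≫ ψ.hom.hom),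
      fun z ↦ ?_⟩
    have hψ : IsIso (stalkHom ψ.hom.hom z) :=
      (isIso_iff_stalkFunctor_map_iso ψ.hom).mp ψ.isIso_hom z
    rw [stalkComparison_homEquiv, stalkHom_comp]
    infer_instance
  · rintro ⟨β, hβ⟩
    obtain ⟨f, rfl⟩ := ((pullbackPushforwardAdjunction _ i).homEquiv _ _).surjective β
    obtain ⟨ψ⟩ := nonempty_sheafification_iso f fun z ↦ by
      have hz := hβ z
      rw [stalkComparison_homEquiv] at hz
      exact IsIso.of_isIso_comp_left (stalkPullbackIso _ i A.presheaf z).hom _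
    exact ⟨e ≪≫ ψ⟩

end InverseImage

/-! ### Constant inverse images -/

section Constant

variable {R : Type u} [Ring R] {X Z : TopCat.{u}} (W : ModuleCat.{u} R)

/-- The sheaf of locally constant functions. -/
def locallyConstantSheaf (Z : TopCat.{u}) : TopCat.Sheaf (ModuleCat.{u} R) Z :=
  localSections (fun _ ↦ W) fun _ _ ↦ LinearMap.eqLocus (.fst R W W) (.snd R W W)

/-- The value of a germ of a locally constant function, as an isomorphism on the stalk. -/
def locallyConstantStalkIso (z : Z) : (locallyConstantSheaf W Z).presheaf.stalk z ≅ W :=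
  @asIso _ _ _ _ (stalkEval _ _ z) <| (ConcreteCategory.isIso_iff_bijective _).mpr
    ⟨stalkEval_injective (.of_forall fun _ _ h ↦ h.symm), stalkEval_surjective fun m ↦
      ⟨⊤, trivial, ⟨fun _ ↦ m, fun _ ↦ .of_forall fun _ _ ↦ rfl⟩, rfl⟩⟩

lemma locallyConstantStalkIso_germ {z : Z} {U : Opens Z} (hz : z ∈ U)
    (s : (locallyConstantSheaf W Z).presheaf.obj (op U)) :
    (locallyConstantStalkIso W z).hom ((locallyConstantSheaf W Z).presheaf.germ U z hz s) =
      s.1 ⟨z, hz⟩ :=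
  stalkEval_germ hz s

lemma germ_const_bijective (z : Z) :
    Function.Bijective (germ ((Functor.const _).obj W : Z.Presheaf (ModuleCat.{u} R)) ⊤ z
      (Opens.mem_top z)) := by
  set P : Z.Presheaf (ModuleCat.{u} R) := (Functor.const _).obj W
  constructor
  · intro a b hab
    obtain ⟨U, _, _, _, e⟩ := P.germ_eq z (Opens.mem_top z) (Opens.mem_top z) a b hab
    exact e
  · intro a
    obtain ⟨U, hU, s, rfl⟩ := P.exists_germ_eq a
    exact ⟨s, (P.germ_res_apply (homOfLE le_top : U ⟶ ⊤) z hU s).symm⟩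

lemma nonempty_constantSheaf_iso_locallyConstantSheaf (Z : TopCat.{u}) :
    Nonempty ((constantSheaf (Opens.grothendieckTopology Z) (ModuleCat.{u} R)).obj W ≅
      locallyConstantSheaf W Z) := by
  let f : (Functor.const _).obj W ⟶ (locallyConstantSheaf W Z).presheaf :=
    { app := fun U ↦ ModuleCat.ofHom
        { toFun := fun w ↦ ⟨fun _ ↦ w, fun _ ↦ .of_forall fun _ _ ↦ rfl⟩
          map_add' := fun _ _ ↦ rfl
          map_smul' := fun _ _ ↦ rfl }
      naturality := fun _ _ _ ↦ rfl }
  refine nonempty_sheafification_iso f fun z ↦ ?_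
  have hgerm := (ConcreteCategory.isIso_iff_bijective _).mpr (germ_const_bijective W z)
  have hf : germ _ ⊤ z (Opens.mem_top z) ≫ stalkHom f z =
      (locallyConstantStalkIso W z).inv := by
    rw [← cancel_mono (locallyConstantStalkIso W z).hom, germ_stalkHom, Category.assoc,
      Iso.inv_hom_id]
    exact ModuleCat.hom_ext <| LinearMap.ext fun w ↦ locallyConstantStalkIso_germ W _ (f.app _ w)
  have : IsIso (germ _ ⊤ z (Opens.mem_top z) ≫ stalkHom f z) :=
    hf ▸ inferInstance
  exact IsIso.of_isIso_comp_left (germ _ ⊤ z (Opens.mem_top z)) _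

/-- A family of isomorphisms between the stalks of `A` along `i` and `W`, such that the values
of sections of `A` are locally constant. -/
structure StalkTrivialization (i : Z ⟶ X) (A : TopCat.Sheaf (ModuleCat.{u} R) X) where
  iso : ∀ z : Z, A.presheaf.stalk (i z) ≅ W
  eventually_eq : ∀ (U : Opens X) (s : A.presheaf.obj (op U)) (z : Z) (hz : i z ∈ U),
    ∀ᶠ z' in 𝓝 z, ∀ hz' : i z' ∈ U, (iso z').hom (A.presheaf.germ U (i z') hz' s) =
      (iso z).hom (A.presheaf.germ U (i z) hz s)

variable {i : Z ⟶ X} {A : TopCat.Sheaf (ModuleCat.{u} R) X}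

variable {W} in
/-- The trivialization of the stalks of `A` given by a stalkwise bijective morphism to the direct
image of the sheaf of locally constant functions. -/
def StalkTrivialization.ofHom
    (β : A.presheaf ⟶ (pushforward _ i).obj (locallyConstantSheaf W Z).presheaf)
    (hβ : ∀ z, IsIso (stalkComparison β z)) : StalkTrivialization W i A where
  iso z := asIso (stalkComparison β z) ≪≫ locallyConstantStalkIso W z
  eventually_eq U s z hz := by
    have hval : ∀ (z' : Z) (hz' : i z' ∈ U), (locallyConstantStalkIso W z').hom
        (stalkComparison β z' (A.presheaf.germ U (i z') hz' s)) =
          (β.app (op U) s).1 ⟨z', hz'⟩ := fun z' hz' ↦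
      (congrArg _ congr($(germ_stalkComparison β hz') s)).trans
        (locallyConstantStalkIso_germ W _ _)
    filter_upwards [(β.app (op U) s).2 ⟨z, hz⟩] with z' h hz'
    exact ((hval z' hz').trans (h hz').symm).trans (hval z hz).symm

variable {W} in
/-- The morphism to the direct image of the sheaf of locally constant functions which takes a
section to its values under a trivialization of the stalks. -/
def StalkTrivialization.hom (τ : StalkTrivialization W i A) :
    A.presheaf ⟶ (pushforward _ i).obj (locallyConstantSheaf W Z).presheaf where
  app U := ModuleCat.ofHom
    { toFun := fun s ↦ ⟨fun z ↦ (τ.iso z.1).hom (A.presheaf.germ U.unop (i z.1) z.2 s), fun z ↦ by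
        filter_upwards [τ.eventually_eq U.unop s z.1 z.2] with z' h hz' using (h hz').symm⟩
      map_add' := fun s t ↦ Subtype.ext (funext fun z ↦
        (A.presheaf.germ U.unop (i z.1) z.2 ≫ (τ.iso z.1).hom).hom.map_add s t)
      map_smul' := fun a s ↦ Subtype.ext (funext fun z ↦
        (A.presheaf.germ U.unop (i z.1) z.2 ≫ (τ.iso z.1).hom).hom.map_smul a s) }
  naturality U U' j := by
    ext s
    exact Subtype.ext (funext fun z ↦ congrArg (τ.iso z.1).hom
      (A.presheaf.germ_res_apply j.unop (i z.1) z.2 s))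

variable {W} in
lemma StalkTrivialization.stalkComparison_hom (τ : StalkTrivialization W i A) (z : Z) :
    stalkComparison τ.hom z = (τ.iso z).hom ≫ (locallyConstantStalkIso W z).inv := by
  rw [Iso.eq_comp_inv]
  refine stalk_hom_ext _ fun U hz ↦ ModuleCat.hom_ext <| LinearMap.ext fun s ↦ ?_
  exact (congrArg _ congr($(germ_stalkComparison τ.hom hz) s)).trans
    (locallyConstantStalkIso_germ W _ _)

lemma nonempty_stalkTrivialization_iff : Nonempty (StalkTrivialization W i A) ↔
    Nonempty ((TopCat.Sheaf.pullback (ModuleCat.{u} R) i).obj A ≅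
      (constantSheaf (Opens.grothendieckTopology Z) (ModuleCat.{u} R)).obj W) := by
  obtain ⟨e⟩ := nonempty_constantSheaf_iso_locallyConstantSheaf W Z
  have he : Nonempty ((TopCat.Sheaf.pullback (ModuleCat.{u} R) i).obj A ≅
      (constantSheaf (Opens.grothendieckTopology Z) (ModuleCat.{u} R)).obj W) ↔
      Nonempty ((TopCat.Sheaf.pullback (ModuleCat.{u} R) i).obj A ≅ locallyConstantSheaf W Z) :=
    ⟨.map (· ≪≫ e), .map (· ≪≫ e.symm)⟩
  rw [he, nonempty_pullback_iso_iff]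
  constructor
  · rintro ⟨τ⟩
    exact ⟨τ.hom, fun z ↦ τ.stalkComparison_hom z ▸ inferInstance⟩
  · rintro ⟨β, hβ⟩
    exact ⟨.ofHom β hβ⟩

end Constant

end PerverseSheaves

end

noncomputable section

namespace PerverseSheaves

open AbstractSimplicialComplex

/-! ### Modules and linear algebra data -/

section Modules

variable {F : Type u} [Field F] {V : Type u} [Fintype V] {K : AbstractSimplicialComplex V}
  {δ : ℕ → ℤ}

lemma idemB_mul_self (Δ : K.Simplex) : idemB F K δ Δ * idemB F K δ Δ = idemB F K δ Δ := by
  unfold idemB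
  rw [← map_mul, ← map_mul, RingQuot.mkAlgHom_rel F (PathRel.idem Δ)]

lemma idemB_mul_of_ne {Δ Δ' : K.Simplex} (h : Δ ≠ Δ') :
    idemB F K δ Δ * idemB F K δ Δ' = 0 := by
  unfold idemB
  rw [← map_mul, ← map_mul, RingQuot.mkAlgHom_rel F (PathRel.orth Δ Δ' h), map_zero, map_zero]

lemma sum_idemB : ∑ Δ : K.Simplex, idemB F K δ Δ = 1 := by
  unfold idemB
  rw [← map_sum, ← map_sum, RingQuot.mkAlgHom_rel F PathRel.one, map_one, map_one]

lemma genB_mul_idemB {Δ Δ' : K.Simplex} (h : K.HasArrow δ Δ Δ') :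
    genB F K δ h * idemB F K δ Δ = genB F K δ h := by
  unfold idemB genB arrowElt
  rw [← map_mul, ← map_mul, RingQuot.mkAlgHom_rel F (PathRel.source ⟨(Δ, Δ'), h⟩)]

lemma subalgebra_eq_top_of_mem (S : Subalgebra F (AlgebraB F K δ))
    (hidem : ∀ Δ, idemB F K δ Δ ∈ S)
    (hgen : ∀ {Δ Δ' : K.Simplex} (h : K.HasArrow δ Δ Δ'), genB F K δ h ∈ S) : S = ⊤ := by
  rw [eq_top_iff]
  rintro b -
  obtain ⟨b, rfl⟩ := RingQuot.mkAlgHom_surjective F _ b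
  obtain ⟨b, rfl⟩ := RingQuot.mkAlgHom_surjective F _ b
  induction b using FreeAlgebra.induction with
  | grade0 r => simpa only [AlgHom.commutes] using S.algebraMap_mem r
  | grade1 x =>
    rcases x with Δ | ⟨⟨Δ, Δ'⟩, h⟩
    · exact hidem Δ
    · exact hgen h
  | mul a b ha hb => simpa only [map_mul] using S.mul_mem ha hb
  | add a b ha hb => simpa only [map_add] using S.add_mem ha hb

open scoped ModuleCat

variable (M N : ModuleCat.{u} (AlgebraB F K δ))

lemma act_idemB_of_mem {Δ : K.Simplex} {m : M} (hm : m ∈ stalkSubmodule M Δ) :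
    act M (idemB F K δ Δ) m = m := by
  obtain ⟨m, rfl⟩ := hm
  rw [← act_mul, idemB_mul_self]

lemma act_idemB_of_mem_ne {Δ Δ' : K.Simplex} (h : Δ ≠ Δ') {m : M}
    (hm : m ∈ stalkSubmodule M Δ') : act M (idemB F K δ Δ) m = 0 := by
  obtain ⟨m, rfl⟩ := hm
  rw [← act_mul, idemB_mul_of_ne h]
  exact zero_smul _ m

lemma sum_act_idemB (m : M) : ∑ Δ : K.Simplex, act M (idemB F K δ Δ) m = m := by
  have : ∑ Δ : K.Simplex, act M (idemB F K δ Δ) m = (∑ Δ : K.Simplex, idemB F K δ Δ) • m :=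
    (Finset.sum_smul ..).symm
  rw [this, sum_idemB, one_smul]

/-- The projection of `M` onto `e_Δ M`. -/
def stalkProj (Δ : K.Simplex) : M →ₗ[F] stalkSubmodule M Δ :=
  (act M (idemB F K δ Δ)).rangeRestrict

variable {M N}

lemma stalkProj_of_mem {Δ : K.Simplex} {m : M} (hm : m ∈ stalkSubmodule M Δ) :
    stalkProj M Δ m = ⟨m, hm⟩ :=
  Subtype.ext (act_idemB_of_mem M hm)

lemma stalkProj_of_mem_ne {Δ Δ' : K.Simplex} (h : Δ ≠ Δ') {m : M}
    (hm : m ∈ stalkSubmodule M Δ') : stalkProj M Δ m = 0 :=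
  Subtype.ext (act_idemB_of_mem_ne M h hm)

/-- The map `M → N` assembled from maps `e_Δ M → e_Δ N`. -/
def assembleLinear (α : ∀ Δ, stalkSubmodule M Δ →ₗ[F] stalkSubmodule N Δ) : M →ₗ[F] N :=
  ∑ Δ, (Submodule.subtype _).comp ((α Δ).comp (stalkProj M Δ))

lemma assembleLinear_of_mem (α : ∀ Δ, stalkSubmodule M Δ →ₗ[F] stalkSubmodule N Δ)
    {Δ : K.Simplex} {m : M} (hm : m ∈ stalkSubmodule M Δ) :
    assembleLinear α m = (α Δ ⟨m, hm⟩).1 := by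
  unfold assembleLinear
  rw [LinearMap.sum_apply, Finset.sum_eq_single Δ]
  · change (α Δ (stalkProj M Δ m)).1 = _
    rw [stalkProj_of_mem hm]
  · intro Δ' _ h
    change (α Δ' (stalkProj M Δ' m)).1 = _
    rw [stalkProj_of_mem_ne h hm, map_zero]
    rfl
  · simp

lemma act_idemB_assembleLinear (α : ∀ Δ, stalkSubmodule M Δ →ₗ[F] stalkSubmodule N Δ)
    (Δ : K.Simplex) (m : M) :
    act N (idemB F K δ Δ) (assembleLinear α m) = (α Δ (stalkProj M Δ m)).1 := by
  unfold assembleLinear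
  rw [LinearMap.sum_apply, map_sum, Finset.sum_eq_single Δ]
  · exact act_idemB_of_mem N (α Δ (stalkProj M Δ m)).2
  · intro Δ' _ h
    exact act_idemB_of_mem_ne N h.symm (α Δ' (stalkProj M Δ' m)).2
  · simp

lemma act_add (a b : AlgebraB F K δ) (m : M) : act M (a + b) m = act M a m + act M b m :=
  add_smul a b m

lemma act_algebraMap (r : F) (m : M) : act M (algebraMap F _ r) m = r • m :=
  algebraMap_smul _ r m

lemma stalkRes_stalkProj {Δ Δ' : K.Simplex} (h : K.HasArrow δ Δ Δ') (m : M) :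
    stalkRes M h (stalkProj M Δ m) = ⟨act M (genB F K δ h) m, act_genB_mem F K δ M h m⟩ :=
  Subtype.ext <| by
    change act M (genB F K δ h) (act M (idemB F K δ Δ) m) = _
    rw [← act_mul, genB_mul_idemB]

lemma assembleLinear_act_genB {α : ∀ Δ, stalkSubmodule M Δ →ₗ[F] stalkSubmodule N Δ}
    {Δ Δ' : K.Simplex} {h : K.HasArrow δ Δ Δ'}
    (hα : ∀ m, α Δ' (stalkRes M h m) = stalkRes N h (α Δ m)) (m : M) :
    assembleLinear α (act M (genB F K δ h) m) = act N (genB F K δ h) (assembleLinear α m) := by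
  rw [assembleLinear_of_mem α (act_genB_mem F K δ M h m), ← stalkRes_stalkProj, hα]
  change act N (genB F K δ h) (α Δ (stalkProj M Δ m)).1 = _
  rw [← act_idemB_assembleLinear, ← act_mul, genB_mul_idemB]

/-- The elements of `B(K, δ)` whose action commutes with a given linear map. -/
def commutingSubalgebra (f : M →ₗ[F] N) : Subalgebra F (AlgebraB F K δ) where
  carrier := {b | ∀ m, f (act M b m) = act N b (f m)}
  mul_mem' := fun ha hb m ↦ by rw [act_mul, ha, hb, act_mul]
  add_mem' := fun ha hb m ↦ by rw [act_add, map_add, ha, hb, act_add]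
  algebraMap_mem' := fun r m ↦ by rw [act_algebraMap, act_algebraMap, map_smul]

lemma assembleLinear_act (α : ∀ Δ, stalkSubmodule M Δ →ₗ[F] stalkSubmodule N Δ)
    (hα : ∀ {Δ Δ' : K.Simplex} (h : K.HasArrow δ Δ Δ') (m : stalkSubmodule M Δ),
      α Δ' (stalkRes M h m) = stalkRes N h (α Δ m)) (b : AlgebraB F K δ) (m : M) :
    assembleLinear α (act M b m) = act N b (assembleLinear α m) := by
  have htop : commutingSubalgebra (assembleLinear α) = ⊤ :=
    subalgebra_eq_top_of_mem _
      (fun Δ m ↦ (assembleLinear_of_mem α (Δ := Δ) ⟨m, rfl⟩).trans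
        (act_idemB_assembleLinear α Δ m).symm)
      (fun h m ↦ assembleLinear_act_genB (hα h) m)
  exact (htop ▸ Algebra.mem_top : b ∈ commutingSubalgebra (assembleLinear α)) m

instance : (K.moduleData F δ).Faithful where
  map_injective {M N f g} h := by
    have eq_on_stalk (Δ : K.Simplex) (m : M) :
        f.hom (act M (idemB F K δ Δ) m) = g.hom (act M (idemB F K δ Δ) m) :=
      congrArg Subtype.val
        (congr($(congrFun (congrArg LinearData.Hom.app h) Δ) (stalkProj M Δ m)) :
          stalkMap f Δ (stalkProj M Δ m) = stalkMap g Δ (stalkProj M Δ m))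
    ext m
    rw [← sum_act_idemB M m, map_sum, map_sum]
    exact Finset.sum_congr rfl fun Δ _ ↦ eq_on_stalk Δ m

instance : (K.moduleData F δ).Full where
  map_surjective {M N} α := by
    let β : ∀ Δ, stalkSubmodule M Δ →ₗ[F] stalkSubmodule N Δ := fun Δ ↦ (α.app Δ).hom
    have hβ : ∀ {Δ Δ' : K.Simplex} (h : K.HasArrow δ Δ Δ') (m : stalkSubmodule M Δ),
      β Δ' (stalkRes M h m) = stalkRes N h (β Δ m) := fun h m ↦ congr($(α.comm h) m)
    refine ⟨ModuleCat.ofHom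
      { toFun := assembleLinear β
        map_add' := map_add _
        map_smul' := assembleLinear_act β hβ }, ?_⟩
    refine LinearData.Hom.ext (funext fun Δ ↦ ModuleCat.hom_ext (LinearMap.ext fun m ↦ ?_))
    exact Subtype.ext (assembleLinear_of_mem β m.2)

end Modules

section TotalSpace

variable {F : Type u} [Field F] {V : Type u} [Fintype V] {K : AbstractSimplicialComplex V}
  {δ : ℕ → ℤ} (S : LinearData F K δ)

open Classical in
/-- The endomorphism of `∏ S(Δ)` given by a vertex or an arrow. -/
def generatorEnd : K.Simplex ⊕ K.Arrow δ → Module.End F (∀ Δ, S.stalk Δ)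
  | Sum.inl Δ => (LinearMap.single F _ Δ).comp (LinearMap.proj Δ)
  | Sum.inr a => (LinearMap.single F _ a.1.2).comp ((S.res a.2).hom.comp (LinearMap.proj a.1.1))

/-- The action of the quiver algebra on `∏ S(Δ)`. -/
def quiverRep : QuiverAlgebra F K δ →ₐ[F] Module.End F (∀ Δ, S.stalk Δ) :=
  RingQuot.liftAlgHom F ⟨FreeAlgebra.lift F (generatorEnd S), by
    classical
    rintro _ _ (Δ | ⟨Δ, Δ', h⟩ | _ | a | a)
    all_goals
      refine LinearMap.ext fun m ↦ funext fun Δ₀ ↦ ?_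
    · simp [generatorEnd]
    · simp [generatorEnd, h]
    · simp [generatorEnd, Finset.sum_apply]
    · simp [generatorEnd]
    · simp [generatorEnd]⟩

lemma quiverRep_arrowElt {Δ Δ' : K.Simplex} (h : K.HasArrow δ Δ Δ') :
    quiverRep S (arrowElt F K δ h) = generatorEnd S (Sum.inr ⟨(Δ, Δ'), h⟩) := by
  unfold quiverRep arrowElt
  rw [RingQuot.liftAlgHom_mkAlgHom_apply, FreeAlgebra.lift_ι_apply]

/-- The action of `B(K, δ)` on `∏ S(Δ)`. -/
def totalRep : AlgebraB F K δ →ₐ[F] Module.End F (∀ Δ, S.stalk Δ) :=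
  RingQuot.liftAlgHom F ⟨quiverRep S, by
    classical
    rintro _ _ ⟨h₁, h₁', h₂, h₂'⟩
    rw [map_mul, map_mul, quiverRep_arrowElt, quiverRep_arrowElt, quiverRep_arrowElt,
      quiverRep_arrowElt]
    refine LinearMap.ext fun m ↦ ?_
    have := congr($(S.equivalence h₁ h₁' h₂ h₂') (m _))
    simpa [generatorEnd] using congrArg (Pi.single _) this⟩

lemma totalRep_genB {Δ Δ' : K.Simplex} (h : K.HasArrow δ Δ Δ') :
    totalRep S (genB F K δ h) = generatorEnd S (Sum.inr ⟨(Δ, Δ'), h⟩) := by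
  unfold totalRep genB
  rw [RingQuot.liftAlgHom_mkAlgHom_apply, quiverRep_arrowElt]

lemma totalRep_idemB (Δ : K.Simplex) :
    totalRep S (idemB F K δ Δ) = generatorEnd S (Sum.inl Δ) := by
  unfold totalRep idemB
  rw [RingQuot.liftAlgHom_mkAlgHom_apply]
  unfold quiverRep
  rw [RingQuot.liftAlgHom_mkAlgHom_apply, FreeAlgebra.lift_ι_apply]

/-- The product `∏ S(Δ)`, carrying the action of `B(K, δ)`. -/
def TotalSpace : Type u := ∀ Δ, S.stalk Δ

instance : AddCommGroup (TotalSpace S) := inferInstanceAs (AddCommGroup (∀ Δ, S.stalk Δ))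

instance : Module (AlgebraB F K δ) (TotalSpace S) :=
  Module.compHom (∀ Δ, S.stalk Δ) (totalRep S).toRingHom

/-- The module `∏ S(Δ)` over `B(K, δ)`. -/
def totalModule : ModuleCat.{u} (AlgebraB F K δ) := ModuleCat.of _ (TotalSpace S)

open scoped ModuleCat

/-- The module `∏ S(Δ)`, as a vector space. -/
def totalEquiv : totalModule S ≃ₗ[F] (∀ Δ, S.stalk Δ) where
  toFun m := m
  invFun m := m
  left_inv _ := rfl
  right_inv _ := rfl
  map_add' _ _ := rfl
  map_smul' r m :=
    LinearMap.congr_fun ((totalRep S).commutes r) (show ∀ Δ, S.stalk Δ from m)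

lemma totalEquiv_act (b : AlgebraB F K δ) (m : totalModule S) :
    totalEquiv S (act _ b m) = totalRep S b (totalEquiv S m) := rfl

open Classical in
lemma totalEquiv_act_idemB (Δ : K.Simplex) (m : totalModule S) :
    totalEquiv S (act _ (idemB F K δ Δ) m) =
      (Pi.single Δ (totalEquiv S m Δ) : ∀ Δ, S.stalk Δ) := by
  rw [totalEquiv_act, totalRep_idemB]
  rfl

open Classical in
lemma totalEquiv_act_genB {Δ Δ' : K.Simplex} (h : K.HasArrow δ Δ Δ') (m : totalModule S) :
    totalEquiv S (act _ (genB F K δ h) m) =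
      (Pi.single Δ' (S.res h (totalEquiv S m Δ)) : ∀ Δ, S.stalk Δ) := by
  rw [totalEquiv_act, totalRep_genB]
  rfl

/-- The coordinate at `Δ`, as a map from the stalk `e_Δ ∏ S(Δ)` to `S(Δ)`. -/
def totalStalkMap (Δ : K.Simplex) : stalkSubmodule (totalModule S) Δ →ₗ[F] S.stalk Δ :=
  (LinearMap.proj Δ).comp ((totalEquiv S).toLinearMap.comp (Submodule.subtype _))

lemma totalStalkMap_bijective (Δ : K.Simplex) : Function.Bijective (totalStalkMap S Δ) := by
  classical
  constructor
  · rintro ⟨m, hm⟩ ⟨n, hn⟩ h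
    refine Subtype.ext ((totalEquiv S).injective ?_)
    change totalEquiv S m = totalEquiv S n
    rw [← act_idemB_of_mem _ hm, ← act_idemB_of_mem _ hn, totalEquiv_act_idemB,
      totalEquiv_act_idemB]
    exact congrArg (Pi.single Δ) h
  · intro x
    refine ⟨⟨_, ⟨(totalEquiv S).symm (Pi.single Δ x), rfl⟩⟩, ?_⟩
    change totalEquiv S (act _ (idemB F K δ Δ) _) Δ = x
    rw [totalEquiv_act_idemB, LinearEquiv.apply_symm_apply, Pi.single_eq_same, Pi.single_eq_same]

variable {S} in
def linearDataIsoOfBijective {T : LinearData F K δ} (f : S ⟶ T)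
    (hf : ∀ Δ, Function.Bijective (LinearData.Hom.app f Δ)) : S ≅ T :=
  have hiso (Δ : K.Simplex) : IsIso (LinearData.Hom.app f Δ) :=
    (ConcreteCategory.isIso_iff_bijective _).mpr (hf Δ)
  { hom := f
    inv :=
      { app := fun Δ ↦ inv (LinearData.Hom.app f Δ)
        comm := fun h ↦ by
          rw [IsIso.comp_inv_eq, Category.assoc, f.comm h, IsIso.inv_hom_id_assoc] }
    hom_inv_id := LinearData.Hom.ext <| funext fun Δ ↦ IsIso.hom_inv_id (LinearData.Hom.app f Δ)
    inv_hom_id := LinearData.Hom.ext <| funext fun Δ ↦ IsIso.inv_hom_id (LinearData.Hom.app f Δ) }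

/-- The linear algebra data of the module `∏ S(Δ)` are `S`. -/
def moduleDataTotalIso : (K.moduleData F δ).obj (totalModule S) ≅ S :=
  linearDataIsoOfBijective
    { app := fun Δ ↦ ModuleCat.ofHom (totalStalkMap S Δ)
      comm := fun {Δ Δ'} h ↦ by
        classical
        ext m
        change totalEquiv S (act _ (genB F K δ h) m.1) Δ' = S.res h (totalEquiv S m.1 Δ)
        rw [totalEquiv_act_genB, Pi.single_eq_same] }
    (totalStalkMap_bijective S)

variable (F K δ)

/-- The functor from finite-dimensional modules to finite-dimensional linear algebra data. -/
def finModuleData : K.CategoryR F δ ⥤ K.FinLinearData F δ :=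
  ObjectProperty.lift _ (ObjectProperty.ι _ ⋙ K.moduleData F δ) fun M Δ ↦ by
    have : Module.Finite F M.obj := M.property
    exact Module.Finite.range (act M.obj (idemB F K δ Δ))

instance : (finModuleData F K δ).Faithful :=
  Functor.Faithful.of_comp_iso (H := ObjectProperty.ι _ ⋙ K.moduleData F δ)
    (ObjectProperty.liftCompιIso _ _ _)

instance : (finModuleData F K δ).Full :=
  Functor.Full.of_comp_faithful_iso (H := ObjectProperty.ι _ ⋙ K.moduleData F δ)
    (ObjectProperty.liftCompιIso _ _ _)

instance : (finModuleData F K δ).EssSurj where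
  mem_essImage S := by
    have : ∀ Δ, Module.Finite F (S.obj.stalk Δ) := S.property
    have h : Module.Finite F (totalModule S.obj) := Module.Finite.equiv (totalEquiv S.obj).symm
    exact ⟨⟨totalModule S.obj, h⟩,
      ⟨(ObjectProperty.fullyFaithfulι _).preimageIso (moduleDataTotalIso S.obj)⟩⟩

instance : (finModuleData F K δ).IsEquivalence where

end TotalSpace

end PerverseSheaves

end

/-! ### Perversities -/

namespace IsPerversity

variable {δ : ℕ → ℤ} (hδ : IsPerversity δ)
include hδ

lemma neg : IsPerversity (-δ) := by
  refine ⟨by rw [Pi.neg_apply, hδ.1, neg_zero], fun k ↦ ?_⟩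
  obtain ⟨a, -, ha⟩ := hδ.2 k
  have hzero : δ 0 ∈ Set.Icc a (a + k) := ha.mapsTo ⟨le_rfl, k.zero_le⟩
  rw [hδ.1] at hzero
  refine ⟨-(a + k), by linarith [hzero.2], ?_⟩
  have hneg := (Equiv.neg ℤ).bijOn (s := Set.Icc a (a + k)) (t := Set.Icc (-(a + k)) (-(a + k) + k))
    fun i ↦ by simp only [Equiv.neg_apply, Set.mem_Icc]; omega
  exact hneg.comp ha

lemma injective : Function.Injective δ := by
  intro j k h
  obtain ⟨a, -, ha⟩ := hδ.2 (max j k)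
  exact ha.injOn (by simp) (by simp) h

lemma exists_le_of_nonneg {k : ℕ} {i : ℤ} (h0 : 0 ≤ i) (hi : i ≤ δ k) : ∃ j ≤ k, δ j = i := by
  obtain ⟨a, ha, hb⟩ := hδ.2 k
  have hk := hb.mapsTo (show k ∈ Set.Icc 0 k by simp)
  obtain ⟨j, hj, rfl⟩ := hb.surjOn (show i ∈ Set.Icc a (a + k) from ⟨by omega, hi.trans hk.2⟩)
  exact ⟨j, hj.2, rfl⟩

lemma exists_le_of_nonpos {k : ℕ} {i : ℤ} (h0 : i ≤ 0) (hi : δ k ≤ i) : ∃ j ≤ k, δ j = i := by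
  obtain ⟨j, hj, e⟩ := hδ.neg.exists_le_of_nonneg (neg_nonneg.mpr h0) (neg_le_neg hi)
  exact ⟨j, hj, neg_injective e⟩

lemma le_of_nonneg {j k : ℕ} (h0 : 0 ≤ δ j) (h : δ j ≤ δ k) : j ≤ k := by
  obtain ⟨i, hi, e⟩ := hδ.exists_le_of_nonneg h0 h
  exact hδ.injective e ▸ hi

lemma le_of_nonpos {j k : ℕ} (h0 : δ j ≤ 0) (h : δ k ≤ δ j) : j ≤ k :=
  hδ.neg.le_of_nonneg (neg_nonneg.mpr h0) (neg_le_neg h)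

lemma eq_zero_iff {j : ℕ} : δ j = 0 ↔ j = 0 :=
  ⟨fun h ↦ hδ.injective (h.trans hδ.1.symm), fun h ↦ h ▸ hδ.1⟩

lemma one_eq : δ 1 = 1 ∨ δ 1 = -1 := by
  obtain ⟨a, ha, hb⟩ := hδ.2 1
  have h0 := hb.mapsTo (show 0 ∈ Set.Icc 0 1 by simp)
  have h1 := hb.mapsTo (show 1 ∈ Set.Icc 0 1 by simp)
  have hne : δ 1 ≠ 0 := fun h ↦ one_ne_zero (hδ.eq_zero_iff.mp h)
  rw [hδ.1] at h0
  simp only [Set.mem_Icc, Nat.cast_one] at h0 h1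
  omega

end IsPerversity

noncomputable section

namespace PerverseSheaves

open AbstractSimplicialComplex

variable {V : Type u} {K : AbstractSimplicialComplex V}

/-! ### Simplices and the path order -/

section Simplices

lemma simplex_nonempty (Δ : K.Simplex) : Δ.1.Nonempty := (K.isRelLowerSet_faces Δ.2).1

lemma card_eq_dim_add_one (Δ : K.Simplex) : Δ.1.card = Δ.dim + 1 :=
  (Nat.sub_add_cancel (simplex_nonempty Δ).card_pos).symm

lemma exists_simplex_eq {Δ : K.Simplex} {s : Finset V} (hs : s.Nonempty) (h : s ⊆ Δ.1) :
    ∃ D : K.Simplex, D.1 = s :=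
  ⟨⟨s, (K.isRelLowerSet_faces Δ.2).2 h hs⟩, rfl⟩

/-- A vertex as a simplex. -/
def vertexSimplex (v : V) : K.Simplex := ⟨{v}, K.singleton_mem v⟩

lemma vertexSimplex_dim (v : V) : (vertexSimplex v : K.Simplex).dim = 0 := by
  simp [vertexSimplex, Simplex.dim]

lemma vertexSimplex_subset {v : V} {s : Finset V} :
    (vertexSimplex v : K.Simplex).1 ⊆ s ↔ v ∈ s :=
  Finset.singleton_subset_iff

lemma eq_of_subset_of_dim_le {Δ Δ' : K.Simplex} (h : Δ.1 ⊆ Δ'.1) (h' : Δ'.dim ≤ Δ.dim) :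
    Δ = Δ' :=
  Subtype.ext <| Finset.eq_of_subset_of_card_le h <| by
    rw [card_eq_dim_add_one, card_eq_dim_add_one]
    omega

lemma dim_mono {Δ Δ' : K.Simplex} (h : Δ.1 ⊆ Δ'.1) : Δ.dim ≤ Δ'.dim :=
  Nat.sub_le_sub_right (Finset.card_le_card h) 1

lemma incident_symm {Δ Δ' : K.Simplex} (h : Δ.Incident Δ') : Δ'.Incident Δ := Or.symm h

lemma subset_of_incident {Δ Δ' : K.Simplex} (h : Δ.Incident Δ') (h' : Δ.dim ≤ Δ'.dim) :
    Δ.1 ⊆ Δ'.1 := by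
  rcases h with h | h
  · exact h
  · rw [eq_of_subset_of_dim_le h h']

lemma eq_vertexSimplex {Δ : K.Simplex} (h : Δ.dim = 0) {v : V} (hv : v ∈ Δ.1) :
    Δ = vertexSimplex v :=
  (eq_of_subset_of_dim_le (vertexSimplex_subset.mpr hv) (by rw [h]; exact Nat.zero_le _)).symm

lemma subset_of_dim_eq_one {Δ : K.Simplex} (hΔ : Δ.dim = 1) {s : Finset V} {v w : V}
    (hvw : v ≠ w) (hv : v ∈ Δ.1) (hw : w ∈ Δ.1) (hv' : v ∈ s) (hw' : w ∈ s) : Δ.1 ⊆ s := by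
  classical
  have hpair : ({v, w} : Finset V) = Δ.1 := Finset.eq_of_subset_of_card_le
    (Finset.insert_subset hv (Finset.singleton_subset_iff.mpr hw))
    (by rw [card_eq_dim_add_one, hΔ, Finset.card_pair hvw])
  exact hpair ▸ Finset.insert_subset hv' (Finset.singleton_subset_iff.mpr hw')

lemma exists_simplex_between {s t : Finset V} {Δ : K.Simplex} {j : ℕ} (hst : s ⊆ t)
    (ht : t ⊆ Δ.1) (hs : s.card ≤ j + 1) (hj : j + 1 ≤ t.card) :
    ∃ D : K.Simplex, s ⊆ D.1 ∧ D.1 ⊆ t ∧ D.dim = j := by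
  obtain ⟨u, hsu, hut, hu⟩ := Finset.exists_subsuperset_card_eq hst hs hj
  obtain ⟨D, rfl⟩ := exists_simplex_eq (Finset.card_pos.mp (by omega)) (hut.trans ht)
  exact ⟨D, hsu, hut, by rw [card_eq_dim_add_one] at hu; omega⟩

end Simplices

section PathOrder

variable {δ : ℕ → ℤ}

lemma rank_le_of_pathLE {Δ Δ' : K.Simplex} (h : K.PathLE δ Δ Δ') : δ Δ'.dim ≤ δ Δ.dim := by
  induction h with
  | refl => rfl
  | tail _ h ih => exact (by have := h.1; omega : δ _ ≤ δ _).trans ih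

lemma eq_of_pathLE_of_rank_eq {Δ Δ' : K.Simplex} (h : K.PathLE δ Δ Δ')
    (hr : δ Δ.dim = δ Δ'.dim) : Δ = Δ' := by
  rcases Relation.ReflTransGen.cases_head h with h | ⟨D, arrow, path⟩
  · exact h
  · have := arrow.1
    have := rank_le_of_pathLE path
    omega

lemma hasArrow_neg_iff {Δ Δ' : K.Simplex} : K.HasArrow (-δ) Δ Δ' ↔ K.HasArrow δ Δ' Δ := by
  refine and_congr ?_ or_comm
  simp only [Pi.neg_apply]
  omega

lemma pathLE_neg_iff {Δ Δ' : K.Simplex} : K.PathLE (-δ) Δ Δ' ↔ K.PathLE δ Δ' Δ := by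
  have hswap : K.HasArrow (-δ) = Function.swap (K.HasArrow δ) :=
    funext₂ fun _ _ ↦ propext hasArrow_neg_iff
  rw [PathLE, hswap]
  exact Relation.reflTransGen_swap

variable (hδ : IsPerversity δ)
include hδ

lemma subset_of_hasArrow_of_nonneg {Δ Δ' : K.Simplex} (h : K.HasArrow δ Δ Δ')
    (h0 : 0 ≤ δ Δ'.dim) : Δ'.1 ⊆ Δ.1 :=
  subset_of_incident (incident_symm h.2) (hδ.le_of_nonneg h0 (by have := h.1; omega))

lemma subset_of_hasArrow_of_nonpos {Δ Δ' : K.Simplex} (h : K.HasArrow δ Δ Δ')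
    (h0 : δ Δ.dim ≤ 0) : Δ.1 ⊆ Δ'.1 :=
  subset_of_hasArrow_of_nonneg hδ.neg (hasArrow_neg_iff.mpr h) (neg_nonneg.mpr h0)

lemma exists_hasArrow_of_nonneg {Δ B : K.Simplex} (hB : B.1 ⊆ Δ.1) (h0 : 0 ≤ δ B.dim)
    (h : δ B.dim < δ Δ.dim) : ∃ D, K.HasArrow δ Δ D ∧ B.1 ⊆ D.1 := by
  obtain ⟨j, hj, e⟩ := hδ.exists_le_of_nonneg (k := Δ.dim) (i := δ Δ.dim - 1)
    (by omega) (by omega)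
  have hBj : B.dim ≤ j := hδ.le_of_nonneg h0 (by omega)
  obtain ⟨D, hBD, hDΔ, rfl⟩ := exists_simplex_between hB subset_rfl (j := j)
    (by rw [card_eq_dim_add_one]; omega) (by rw [card_eq_dim_add_one]; omega)
  exact ⟨D, ⟨by omega, Or.inr hDΔ⟩, hBD⟩

lemma pathLE_of_subset_of_nonneg {Δ Δ' : K.Simplex} (h : Δ'.1 ⊆ Δ.1) (h0 : 0 ≤ δ Δ'.dim)
    (hle : δ Δ'.dim ≤ δ Δ.dim) : K.PathLE δ Δ Δ' := by
  obtain ⟨n, hn⟩ : ∃ n : ℕ, δ Δ.dim = δ Δ'.dim + n := ⟨(δ Δ.dim - δ Δ'.dim).toNat, by omega⟩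
  induction n generalizing Δ with
  | zero =>
    rw [eq_of_subset_of_dim_le h (hδ.injective (by omega : δ Δ.dim = δ Δ'.dim)).le]
    exact Relation.ReflTransGen.refl
  | succ n ih =>
    obtain ⟨D, arrow, hD⟩ := exists_hasArrow_of_nonneg hδ h h0 (by omega)
    have := arrow.1
    exact Relation.ReflTransGen.head arrow (ih hD (by omega) (by omega))

lemma pathLE_of_subset_of_nonpos {Δ Δ' : K.Simplex} (h : Δ.1 ⊆ Δ'.1) (h0 : δ Δ.dim ≤ 0)
    (hle : δ Δ'.dim ≤ δ Δ.dim) : K.PathLE δ Δ Δ' :=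
  pathLE_neg_iff.mp
    (pathLE_of_subset_of_nonneg hδ.neg h (neg_nonneg.mpr h0) (neg_le_neg hle))

lemma pathLE_of_mem {Δ Δ' : K.Simplex} {v : V} (h : v ∈ Δ.1) (h' : v ∈ Δ'.1)
    (h0 : 0 ≤ δ Δ.dim) (h0' : δ Δ'.dim ≤ 0) : K.PathLE δ Δ Δ' := by
  have hv : δ (vertexSimplex v : K.Simplex).dim = 0 := by rw [vertexSimplex_dim, hδ.1]
  exact Relation.ReflTransGen.trans (b := vertexSimplex v)
    (pathLE_of_subset_of_nonneg hδ (vertexSimplex_subset.mpr h) hv.ge (by omega))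
    (pathLE_of_subset_of_nonpos hδ (vertexSimplex_subset.mpr h') hv.le (by omega))

lemma subset_of_pathLE_of_nonneg {Δ Δ' : K.Simplex} (h : K.PathLE δ Δ Δ') (h0 : 0 ≤ δ Δ'.dim) :
    Δ'.1 ⊆ Δ.1 := by
  induction h using Relation.ReflTransGen.head_induction_on with
  | refl => exact subset_rfl
  | head arrow path ih =>
    exact ih.trans (subset_of_hasArrow_of_nonneg hδ arrow (h0.trans (rank_le_of_pathLE path)))

lemma subset_of_pathLE_of_nonpos {Δ Δ' : K.Simplex} (h : K.PathLE δ Δ Δ') (h0 : δ Δ.dim ≤ 0) :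
    Δ.1 ⊆ Δ'.1 :=
  subset_of_pathLE_of_nonneg hδ.neg (pathLE_neg_iff.mpr h) (neg_nonneg.mpr h0)

lemma exists_mem_of_pathLE {Δ Δ' : K.Simplex} (h : K.PathLE δ Δ Δ') : ∃ v ∈ Δ.1, v ∈ Δ'.1 := by
  induction h using Relation.ReflTransGen.head_induction_on with
  | refl => exact (simplex_nonempty Δ').imp fun v hv ↦ ⟨hv, hv⟩
  | @head D D' arrow path ih =>
    by_cases hD : δ D.dim ≤ 0
    · exact (simplex_nonempty D).imp fun v hv ↦
        ⟨hv, subset_of_pathLE_of_nonpos hδ (.head arrow path) hD hv⟩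
    · have := arrow.1
      obtain ⟨v, hv, hv'⟩ := ih
      exact ⟨v, subset_of_hasArrow_of_nonneg hδ arrow (by omega) hv, hv'⟩

omit hδ in
lemma exists_mem_of_incident {Δ Δ' : K.Simplex} (h : Δ.Incident Δ') : ∃ v ∈ Δ.1, v ∈ Δ'.1 := by
  rcases h with h | h
  · exact (simplex_nonempty Δ).imp fun v hv ↦ ⟨hv, h hv⟩
  · exact (simplex_nonempty Δ').imp fun v hv ↦ ⟨h hv, hv⟩

lemma pathLE_of_incident {Δ Δ' : K.Simplex} (h : Δ.Incident Δ') (hle : δ Δ'.dim ≤ δ Δ.dim) :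
    K.PathLE δ Δ Δ' := by
  by_cases h0 : 0 ≤ δ Δ'.dim
  · exact pathLE_of_subset_of_nonneg hδ
      (subset_of_incident (incident_symm h) (hδ.le_of_nonneg h0 hle)) h0 hle
  by_cases h1 : δ Δ.dim ≤ 0
  · exact pathLE_of_subset_of_nonpos hδ (subset_of_incident h (hδ.le_of_nonpos h1 hle)) h1 hle
  obtain ⟨v, hv, hv'⟩ := exists_mem_of_incident h
  exact pathLE_of_mem hδ hv hv' (by omega) (by omega)

lemma exists_incident_between {Δ Δ' : K.Simplex} (h : Δ.Incident Δ')
    (hlt : δ Δ'.dim + 1 < δ Δ.dim) :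
    ∃ D : K.Simplex, Δ.Incident D ∧ D.Incident Δ' ∧ δ Δ'.dim < δ D.dim ∧ δ D.dim < δ Δ.dim := by
  by_cases h0 : 0 ≤ δ Δ'.dim
  · obtain ⟨D, arrow, hD⟩ := exists_hasArrow_of_nonneg hδ
      (subset_of_incident (incident_symm h) (hδ.le_of_nonneg h0 (by omega))) h0 (by omega)
    have := arrow.1
    exact ⟨D, arrow.2, Or.inr hD, by omega, by omega⟩
  by_cases h1 : δ Δ.dim ≤ 0
  · obtain ⟨D, arrow, hD⟩ := exists_hasArrow_of_nonneg hδ.neg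
      (subset_of_incident h (hδ.le_of_nonpos h1 (by omega))) (neg_nonneg.mpr h1)
      (neg_lt_neg (by omega))
    have := (hasArrow_neg_iff.mp arrow).1
    exact ⟨D, Or.inl hD, (hasArrow_neg_iff.mp arrow).2, by omega, by omega⟩
  obtain ⟨v, hv, hv'⟩ := exists_mem_of_incident h
  refine ⟨vertexSimplex v, Or.inr (vertexSimplex_subset.mpr hv),
    Or.inl (vertexSimplex_subset.mpr hv'), ?_, ?_⟩ <;>
  · rw [vertexSimplex_dim, hδ.1]
    omega

/-- In the case `δ(Δ') = 1`, `δ(Δ'') = -1` the middle simplices are vertices, and one of `Δ'`, `Δ''`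
is the edge joining them. -/
lemma incident_of_two_paths {Δ' Δ₁ Δ₂ Δ'' : K.Simplex} (h₁ : K.HasArrow δ Δ' Δ₁)
    (h₁' : K.HasArrow δ Δ₁ Δ'') (h₂ : K.HasArrow δ Δ' Δ₂) (h₂' : K.HasArrow δ Δ₂ Δ'')
    (hne : Δ₁ ≠ Δ₂) : Δ'.Incident Δ'' := by
  have e1 := h₁.1
  have e1' := h₁'.1
  have e2 := h₂.1
  by_cases h0 : 0 ≤ δ Δ''.dim
  · exact Or.inr ((subset_of_hasArrow_of_nonneg hδ h₁' h0).trans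
      (subset_of_hasArrow_of_nonneg hδ h₁ (by omega)))
  by_cases h1 : δ Δ'.dim ≤ 0
  · exact Or.inl ((subset_of_hasArrow_of_nonpos hδ h₁ h1).trans
      (subset_of_hasArrow_of_nonpos hδ h₁' (by omega)))
  obtain ⟨v, hv⟩ := simplex_nonempty Δ₁
  obtain ⟨w, hw⟩ := simplex_nonempty Δ₂
  have hvw : v ≠ w := fun h ↦ hne <|
    (eq_vertexSimplex (hδ.eq_zero_iff.mp (by omega)) hv).trans
      (h ▸ (eq_vertexSimplex (hδ.eq_zero_iff.mp (by omega)) hw).symm)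
  have hv' := subset_of_hasArrow_of_nonneg hδ h₁ (by omega) hv
  have hw' := subset_of_hasArrow_of_nonneg hδ h₂ (by omega) hw
  have hv'' := subset_of_hasArrow_of_nonpos hδ h₁' (by omega) hv
  have hw'' := subset_of_hasArrow_of_nonpos hδ h₂' (by omega) hw
  rcases hδ.one_eq with h | h
  · exact Or.inl (subset_of_dim_eq_one (hδ.injective (by omega)) hvw hv' hw' hv'' hw'')
  · exact Or.inr (subset_of_dim_eq_one (hδ.injective (by omega)) hvw hv'' hw'' hv' hw')

end PathOrder

end PerverseSheaves

end

noncomputable section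

namespace PerverseSheaves

open AbstractSimplicialComplex

variable {V : Type u} {K : AbstractSimplicialComplex V}

/-! ### Path independence -/

section Exchange

/-- `D` and `D'` are `d`-dimensional simplices between `A` and `B` which differ in at most one
vertex. -/
def IsExchange (A B : Finset V) (d : ℕ) (D D' : K.Simplex) : Prop :=
  D.dim = d ∧ D'.dim = d ∧ (∃ C, A ⊆ C ∧ C ⊆ D.1 ∧ C ⊆ D'.1 ∧ d ≤ C.card) ∧
    ∃ U, D.1 ⊆ U ∧ D'.1 ⊆ U ∧ U ⊆ B ∧ U.card ≤ d + 2

open Classical in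
lemma exists_isExchange_card_sdiff_lt {A : Finset V} {B D D' : K.Simplex} {d : ℕ}
    (hD : D.dim = d) (hD' : D'.dim = d) (hA : A ⊆ D.1) (hA' : A ⊆ D'.1) (hB : D.1 ⊆ B.1)
    (hB' : D'.1 ⊆ B.1) (hne : D ≠ D') :
    ∃ E : K.Simplex, IsExchange A B.1 d D E ∧ A ⊆ E.1 ∧ E.1 ⊆ B.1 ∧
      (E.1 \ D'.1).card < (D.1 \ D'.1).card := by
  obtain ⟨v, hv, hv'⟩ := Finset.not_subset.mp fun h ↦
    hne (eq_of_subset_of_dim_le h (hD'.trans hD.symm).le)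
  obtain ⟨w, hw', hw⟩ := Finset.not_subset.mp fun h ↦
    hne.symm (eq_of_subset_of_dim_le h (hD.trans hD'.symm).le)
  have hwB : insert w D.1 ⊆ B.1 := Finset.insert_subset (hB' hw') hB
  have hEw : insert w (D.1.erase v) ⊆ insert w D.1 :=
    Finset.insert_subset_insert w (Finset.erase_subset v D.1)
  have hAv : A ⊆ D.1.erase v := Finset.subset_erase.mpr ⟨hA, fun h ↦ hv' (hA' h)⟩
  have hcard : (D.1.erase v).card = d := by
    rw [Finset.card_erase_of_mem hv, card_eq_dim_add_one, hD, Nat.add_sub_cancel]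
  obtain ⟨E, hE⟩ := exists_simplex_eq (Finset.insert_nonempty w _) (hEw.trans hwB)
  have hEdim : E.dim = d := by
    have h := card_eq_dim_add_one E
    rw [hE, Finset.card_insert_of_notMem (fun h ↦ hw (Finset.mem_of_mem_erase h)), hcard] at h
    omega
  refine ⟨E, ⟨hD, hEdim, ⟨D.1.erase v, hAv, Finset.erase_subset v _, ?_, hcard.ge⟩,
    ⟨insert w D.1, Finset.subset_insert w _, hE ▸ hEw, hwB, ?_⟩⟩, ?_, hE ▸ hEw.trans hwB, ?_⟩
  · exact hE ▸ Finset.subset_insert w _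
  · exact (Finset.card_insert_le w D.1).trans (by rw [card_eq_dim_add_one, hD])
  · exact hE ▸ hAv.trans (Finset.subset_insert w _)
  · refine Finset.card_lt_card (Finset.ssubset_iff_of_subset ?_ |>.mpr ⟨v, ?_, ?_⟩)
    all_goals grind

open Classical in
lemma reflTransGen_isExchange {A : Finset V} {B D D' : K.Simplex} {d : ℕ} (hD : D.dim = d)
    (hD' : D'.dim = d) (hA : A ⊆ D.1) (hA' : A ⊆ D'.1) (hB : D.1 ⊆ B.1) (hB' : D'.1 ⊆ B.1) :
    Relation.ReflTransGen (IsExchange A B.1 d) D D' := by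
  induction hn : (D.1 \ D'.1).card using Nat.strong_induction_on generalizing D with
  | _ n ih =>
    rcases eq_or_ne D D' with rfl | hne
    · exact .refl
    · obtain ⟨E, hDE, hAE, hEB, hlt⟩ :=
        exists_isExchange_card_sdiff_lt hD hD' hA hA' hB hB' hne
      exact .head hDE (ih _ (hn ▸ hlt) hDE.2.1 hAE hEB rfl)

end Exchange

section Linked

/-- Two first steps `D`, `D'` of paths from `Δ` to `Δ'` which can be followed by a common
second step. -/
def Linked (δ : ℕ → ℤ) (Δ Δ' D D' : K.Simplex) : Prop :=
  K.HasArrow δ Δ D ∧ K.HasArrow δ Δ D' ∧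
    ∃ E, K.HasArrow δ D E ∧ K.HasArrow δ D' E ∧ K.PathLE δ E Δ'

variable {δ : ℕ → ℤ} (hδ : IsPerversity δ)
include hδ

lemma linked_of_common_face {Δ Δ' B D D' : K.Simplex} {t : Finset V} {d : ℕ}
    (hD : K.HasArrow δ Δ D) (hD' : K.HasArrow δ Δ D')
    (h0 : 0 ≤ δ B.dim) (hlt : δ B.dim < δ d) (hB : K.PathLE δ B Δ')
    (ex : IsExchange B.1 t d D D') : Linked δ Δ Δ' D D' := by
  obtain ⟨rfl, hdim, ⟨C, hBC, hCD, hCD', hC⟩, -⟩ := ex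
  obtain ⟨j, hj, e⟩ := hδ.exists_le_of_nonneg (k := D.dim) (i := δ D.dim - 1) (by omega) (by omega)
  have hjne : j ≠ D.dim := fun h ↦ by rw [h] at e; omega
  have hBj : B.dim ≤ j := hδ.le_of_nonneg h0 (by omega)
  obtain ⟨E, hBE, hEC, rfl⟩ := exists_simplex_between hBC hCD (j := j)
    (by rw [card_eq_dim_add_one]; omega) (by omega)
  exact ⟨hD, hD', E, ⟨by omega, Or.inr (hEC.trans hCD)⟩,
    ⟨by rw [hdim]; omega, Or.inr (hEC.trans hCD')⟩,
    (pathLE_of_subset_of_nonneg hδ hBE h0 (by omega)).trans hB⟩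

lemma linked_of_common_coface {Δ Δ' D D' : K.Simplex} {s : Finset V} {d : ℕ}
    (hD : K.HasArrow δ Δ D) (hD' : K.HasArrow δ Δ D') (h0 : δ d ≤ 0) (hlt : δ Δ'.dim < δ d)
    (ex : IsExchange s Δ'.1 d D D') : Linked δ Δ Δ' D D' := by
  obtain ⟨rfl, hdim, -, ⟨U, hDU, hDU', hUΔ', hU⟩⟩ := ex
  obtain ⟨j, hj, e⟩ := hδ.exists_le_of_nonpos (k := Δ'.dim) (i := δ D.dim - 1)
    (by omega) (by omega)
  have hjne : j ≠ D.dim := fun h ↦ by rw [h] at e; omega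
  have hDj : D.dim ≤ j := hδ.le_of_nonpos h0 (by omega)
  obtain ⟨E, hUE, hEΔ', rfl⟩ := exists_simplex_between hUΔ' subset_rfl (j := j) (by omega)
    (by rw [card_eq_dim_add_one]; omega)
  exact ⟨hD, hD', E, ⟨by omega, Or.inl (hDU.trans hUE)⟩,
    ⟨by rw [hdim]; omega, Or.inl (hDU'.trans hUE)⟩,
    pathLE_of_subset_of_nonpos hδ hEΔ' (by omega) (by omega)⟩

lemma linked_chain_of_common_face {Δ Δ' B D D' : K.Simplex} (hD : K.HasArrow δ Δ D)
    (hD' : K.HasArrow δ Δ D') (hBD : B.1 ⊆ D.1) (hBD' : B.1 ⊆ D'.1) (h0 : 0 ≤ δ B.dim)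
    (hlt : δ B.dim < δ D.dim) (hB : K.PathLE δ B Δ') :
    Relation.ReflTransGen (Linked δ Δ Δ') D D' := by
  have e := hD.1
  have e' := hD'.1
  refine Relation.ReflTransGen.mono (fun D₁ D₂ ex ↦ ?_) _ _
    (reflTransGen_isExchange rfl (hδ.injective (by omega)) hBD hBD'
      (subset_of_hasArrow_of_nonneg hδ hD (by omega))
      (subset_of_hasArrow_of_nonneg hδ hD' (by omega)))
  have arrow {E : K.Simplex} (hE : E.dim = D.dim) (hEΔ : E.1 ⊆ Δ.1) : K.HasArrow δ Δ E :=
    ⟨hE ▸ e, Or.inr hEΔ⟩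
  obtain ⟨U, hU, hU', hUΔ, -⟩ := ex.2.2.2
  exact linked_of_common_face hδ (arrow ex.1 (hU.trans hUΔ)) (arrow ex.2.1 (hU'.trans hUΔ))
    h0 hlt hB ex

lemma linked_chain_of_nonpos {Δ Δ' D D' : K.Simplex} (hD : K.HasArrow δ Δ D)
    (hD' : K.HasArrow δ Δ D') (hDΔ' : D.1 ⊆ Δ'.1) (hDΔ'' : D'.1 ⊆ Δ'.1) (h0 : δ Δ.dim ≤ 0)
    (hlt : δ Δ'.dim < δ D.dim) : Relation.ReflTransGen (Linked δ Δ Δ') D D' := by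
  have e := hD.1
  have e' := hD'.1
  refine Relation.ReflTransGen.mono (fun D₁ D₂ ex ↦ ?_) _ _
    (reflTransGen_isExchange rfl (hδ.injective (by omega))
      (subset_of_hasArrow_of_nonpos hδ hD h0) (subset_of_hasArrow_of_nonpos hδ hD' h0)
      hDΔ' hDΔ'')
  have arrow {E : K.Simplex} (hE : E.dim = D.dim) (hEΔ : Δ.1 ⊆ E.1) : K.HasArrow δ Δ E :=
    ⟨hE ▸ e, Or.inl hEΔ⟩
  obtain ⟨C, hC, hCD, hCD', -⟩ := ex.2.2.1
  exact linked_of_common_coface hδ (arrow ex.1 (hC.trans hCD)) (arrow ex.2.1 (hC.trans hCD'))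
    (by omega) hlt ex

lemma linked_chain_of_rank_eq_one {Δ Δ' D D' : K.Simplex} (hD : K.HasArrow δ Δ D)
    (hD' : K.HasArrow δ Δ D') (hDΔ' : K.PathLE δ D Δ') (hDΔ'' : K.PathLE δ D' Δ')
    (hΔ : δ Δ.dim = 1) (hlt : δ Δ'.dim < δ D.dim) : Linked δ Δ Δ' D D' := by
  classical
  have e := hD.1
  have e' := hD'.1
  have hdim : D.dim = 0 := hδ.eq_zero_iff.mp (by omega)
  have hdim' : D'.dim = 0 := hδ.eq_zero_iff.mp (by omega)
  refine linked_of_common_coface hδ hD hD' (s := ∅) (d := 0) hδ.1.le (hdim ▸ hlt)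
    ⟨hdim, hdim', ⟨∅, subset_rfl, D.1.empty_subset, D'.1.empty_subset, le_rfl⟩, D.1 ∪ D'.1,
      Finset.subset_union_left, Finset.subset_union_right,
      Finset.union_subset (subset_of_pathLE_of_nonpos hδ hDΔ' (by omega))
        (subset_of_pathLE_of_nonpos hδ hDΔ'' (by omega)), ?_⟩
  refine (Finset.card_union_le _ _).trans ?_
  rw [card_eq_dim_add_one, card_eq_dim_add_one, hdim, hdim']

/-- The chain runs from `D` to a simplex containing a vertex of `D ∩ Δ'` and one of `D' ∩ Δ'`,
and from there to `D'`. -/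
lemma linked_chain_of_one_lt {Δ Δ' D D' : K.Simplex} (hD : K.HasArrow δ Δ D)
    (hD' : K.HasArrow δ Δ D') (hDΔ' : K.PathLE δ D Δ') (hDΔ'' : K.PathLE δ D' Δ')
    (hΔ : 1 < δ Δ.dim) (hΔ' : δ Δ'.dim ≤ 0) :
    Relation.ReflTransGen (Linked δ Δ Δ') D D' := by
  classical
  have e := hD.1
  have e' := hD'.1
  have hrank (v : V) : δ (vertexSimplex v : K.Simplex).dim = 0 := by rw [vertexSimplex_dim, hδ.1]
  have hpath {v : V} (hv : v ∈ Δ'.1) : K.PathLE δ (vertexSimplex v) Δ' :=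
    pathLE_of_mem hδ (Finset.mem_singleton_self v) hv (hrank v).ge hΔ'
  obtain ⟨v, hvD, hvΔ'⟩ := exists_mem_of_pathLE hδ hDΔ'
  obtain ⟨w, hwD', hwΔ'⟩ := exists_mem_of_pathLE hδ hDΔ''
  have hDΔ := subset_of_hasArrow_of_nonneg hδ hD (by omega)
  have hD'Δ := subset_of_hasArrow_of_nonneg hδ hD' (by omega)
  have hdim : D.dim ≠ 0 := fun h ↦ by have := hδ.eq_zero_iff.mpr h; omega
  obtain ⟨E, hvwE, hEΔ, hE⟩ := exists_simplex_between (s := {v, w}) (t := Δ.1) (j := D.dim)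
    (Finset.insert_subset (hDΔ hvD) (Finset.singleton_subset_iff.mpr (hD'Δ hwD'))) subset_rfl
    (Finset.card_le_two.trans (by omega)) (card_eq_dim_add_one Δ ▸ Nat.succ_le_succ (dim_mono hDΔ))
  obtain ⟨hvE, hwE⟩ := Finset.insert_subset_iff.mp hvwE
  have hΔE : K.HasArrow δ Δ E := ⟨hE ▸ e, Or.inr hEΔ⟩
  exact (linked_chain_of_common_face hδ hD hΔE (vertexSimplex_subset.mpr hvD)
      (vertexSimplex_subset.mpr hvE) (hrank v).ge (by rw [hrank]; omega) (hpath hvΔ')).trans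
    (linked_chain_of_common_face hδ hΔE hD' hwE (vertexSimplex_subset.mpr hwD') (hrank w).ge
      (by rw [hrank, hE]; omega) (hpath hwΔ'))

lemma linked_chain {Δ Δ' D D' : K.Simplex} (hD : K.HasArrow δ Δ D) (hD' : K.HasArrow δ Δ D')
    (hDΔ' : K.PathLE δ D Δ') (hDΔ'' : K.PathLE δ D' Δ') :
    Relation.ReflTransGen (Linked δ Δ Δ') D D' := by
  have e := hD.1
  have e' := hD'.1
  rcases eq_or_lt_of_le (rank_le_of_pathLE hDΔ') with hr | hlt
  · rw [eq_of_pathLE_of_rank_eq hDΔ' hr.symm, eq_of_pathLE_of_rank_eq hDΔ'' (by omega)]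
  by_cases hΔ : δ Δ.dim ≤ 0
  · exact linked_chain_of_nonpos hδ hD hD' (subset_of_pathLE_of_nonpos hδ hDΔ' (by omega))
      (subset_of_pathLE_of_nonpos hδ hDΔ'' (by omega)) hΔ hlt
  by_cases hΔ' : 0 ≤ δ Δ'.dim
  · exact linked_chain_of_common_face hδ hD hD' (subset_of_pathLE_of_nonneg hδ hDΔ' hΔ')
      (subset_of_pathLE_of_nonneg hδ hDΔ'' hΔ') hΔ' hlt .refl
  by_cases hΔ1 : δ Δ.dim = 1
  · exact .single (linked_chain_of_rank_eq_one hδ hD hD' hDΔ' hDΔ'' hΔ1 hlt)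
  · exact linked_chain_of_one_lt hδ hD hD' hDΔ' hDΔ'' (by omega) (by omega)

end Linked

section PathMap

variable {F : Type u} [Field F] {δ : ℕ → ℤ}

/-- The composites of the restriction maps along paths. -/
inductive IsComposite (S : LinearData F K δ) :
    ∀ Δ Δ' : K.Simplex, (S.stalk Δ ⟶ S.stalk Δ') → Prop
  | refl (Δ : K.Simplex) : IsComposite S Δ Δ (𝟙 _)
  | head {Δ D Δ' : K.Simplex} (h : K.HasArrow δ Δ D) (f : S.stalk D ⟶ S.stalk Δ') :
      IsComposite S D Δ' f → IsComposite S Δ Δ' (S.res h ≫ f)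

variable {S T : LinearData F K δ}

namespace IsComposite

lemma pathLE {Δ Δ' : K.Simplex} {f : S.stalk Δ ⟶ S.stalk Δ'} (hf : IsComposite S Δ Δ' f) :
    K.PathLE δ Δ Δ' := by
  induction hf with
  | refl => exact .refl
  | head h _ _ ih => exact .head h ih

lemma trans {Δ Δ' Δ'' : K.Simplex} {f : S.stalk Δ ⟶ S.stalk Δ'} {g : S.stalk Δ' ⟶ S.stalk Δ''}
    (hf : IsComposite S Δ Δ' f) (hg : IsComposite S Δ' Δ'' g) : IsComposite S Δ Δ'' (f ≫ g) := by
  induction hf with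
  | refl => rwa [Category.id_comp]
  | head h f _ ih =>
    rw [Category.assoc]
    exact .head h _ (ih hg)

lemma exists_of_pathLE (S : LinearData F K δ) {Δ Δ' : K.Simplex} (h : K.PathLE δ Δ Δ') :
    ∃ f, IsComposite S Δ Δ' f := by
  induction h using Relation.ReflTransGen.head_induction_on with
  | refl => exact ⟨_, .refl _⟩
  | head h _ ih =>
    obtain ⟨f, hf⟩ := ih
    exact ⟨_, .head h f hf⟩

lemma res_comp_eq_of_chain {Δ Δ' D₁ D₂ : K.Simplex}
    (hunique : ∀ {D : K.Simplex}, K.HasArrow δ Δ D → ∀ {f g : S.stalk D ⟶ S.stalk Δ'},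
      IsComposite S D Δ' f → IsComposite S D Δ' g → f = g)
    (h : Relation.ReflTransGen (Linked δ Δ Δ') D₁ D₂) (h₁ : K.HasArrow δ Δ D₁)
    (h₂ : K.HasArrow δ Δ D₂) {f₁ : S.stalk D₁ ⟶ S.stalk Δ'} {f₂ : S.stalk D₂ ⟶ S.stalk Δ'}
    (hf₁ : IsComposite S D₁ Δ' f₁) (hf₂ : IsComposite S D₂ Δ' f₂) :
    S.res h₁ ≫ f₁ = S.res h₂ ≫ f₂ := by
  induction h with
  | refl => rw [hunique h₁ hf₁ hf₂]
  | tail _ linked ih =>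
    obtain ⟨h₃, -, E, a₃, a₂, hE⟩ := linked
    obtain ⟨e, he⟩ := exists_of_pathLE S hE
    rw [ih h₃ (.head a₃ e he), hunique h₂ hf₂ (.head a₂ e he), ← Category.assoc,
      ← Category.assoc, S.equivalence h₃ a₃ h₂ a₂]

lemma eq_id {Δ : K.Simplex} {f : S.stalk Δ ⟶ S.stalk Δ} (hf : IsComposite S Δ Δ f) :
    f = 𝟙 _ := by
  cases hf with
  | refl => rfl
  | head arrow _ hg =>
    have := arrow.1
    have := rank_le_of_pathLE hg.pathLE
    omega

lemma exists_head {Δ Δ' : K.Simplex} {f : S.stalk Δ ⟶ S.stalk Δ'} (hf : IsComposite S Δ Δ' f)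
    (hne : Δ ≠ Δ') : ∃ (D : K.Simplex) (h : K.HasArrow δ Δ D) (g : S.stalk D ⟶ S.stalk Δ'),
      IsComposite S D Δ' g ∧ f = S.res h ≫ g := by
  cases hf with
  | refl => exact absurd rfl hne
  | head h g hg => exact ⟨_, h, g, hg, rfl⟩

lemma unique (hδ : IsPerversity δ) {Δ Δ' : K.Simplex} {f g : S.stalk Δ ⟶ S.stalk Δ'}
    (hf : IsComposite S Δ Δ' f) (hg : IsComposite S Δ Δ' g) : f = g := by
  have hle := rank_le_of_pathLE hf.pathLE
  induction hn : (δ Δ.dim - δ Δ'.dim).toNat generalizing Δ with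
  | zero =>
    obtain rfl := eq_of_pathLE_of_rank_eq hf.pathLE (by omega)
    rw [hf.eq_id, hg.eq_id]
  | succ n ih =>
    have hne : Δ ≠ Δ' := fun h ↦ by rw [h, sub_self] at hn; exact absurd hn (by simp)
    obtain ⟨D₁, h₁, f₁, hf₁, rfl⟩ := hf.exists_head hne
    obtain ⟨D₂, h₂, g₂, hg₂, rfl⟩ := hg.exists_head hne
    refine res_comp_eq_of_chain (fun {D} h {f g} hf hg ↦ ?_)
      (linked_chain hδ h₁ h₂ hf₁.pathLE hg₂.pathLE) h₁ h₂ hf₁ hg₂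
    have := h.1
    exact ih hf hg (rank_le_of_pathLE hf.pathLE) (by omega)

lemma exists_comm (α : S ⟶ T) {Δ Δ' : K.Simplex} {f : S.stalk Δ ⟶ S.stalk Δ'}
    (hf : IsComposite S Δ Δ' f) :
    ∃ g, IsComposite T Δ Δ' g ∧ f ≫ LinearData.Hom.app α Δ' = LinearData.Hom.app α Δ ≫ g := by
  induction hf with
  | refl => exact ⟨𝟙 _, .refl _, by rw [Category.id_comp, Category.comp_id]⟩
  | head h f _ ih =>
    obtain ⟨g, hg, e⟩ := ih
    refine ⟨_, .head h g hg, ?_⟩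
    rw [Category.assoc, e, ← Category.assoc, LinearData.Hom.comm α h, Category.assoc]

end IsComposite

/-- The map of stalks given by any path from `Δ` to `Δ'`. -/
def pathMap (S : LinearData F K δ) {Δ Δ' : K.Simplex} (h : K.PathLE δ Δ Δ') :
    S.stalk Δ ⟶ S.stalk Δ' :=
  (IsComposite.exists_of_pathLE S h).choose

lemma isComposite_pathMap (S : LinearData F K δ) {Δ Δ' : K.Simplex} (h : K.PathLE δ Δ Δ') :
    IsComposite S Δ Δ' (pathMap S h) :=
  (IsComposite.exists_of_pathLE S h).choose_spec

section

variable (hδ : IsPerversity δ)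
include hδ

lemma pathMap_refl (S : LinearData F K δ) {Δ : K.Simplex} (h : K.PathLE δ Δ Δ) :
    pathMap S h = 𝟙 _ :=
  (isComposite_pathMap S h).unique hδ (.refl _)

lemma pathMap_of_hasArrow (S : LinearData F K δ) {Δ Δ' : K.Simplex} (h : K.HasArrow δ Δ Δ')
    (h' : K.PathLE δ Δ Δ') : pathMap S h' = S.res h :=
  ((isComposite_pathMap S h').unique hδ (.head h _ (.refl Δ'))).trans (Category.comp_id _)

lemma pathMap_comp (S : LinearData F K δ) {Δ Δ' Δ'' : K.Simplex}
    (h : K.PathLE δ Δ Δ') (h' : K.PathLE δ Δ' Δ'') (h'' : K.PathLE δ Δ Δ'') :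
    pathMap S h ≫ pathMap S h' = pathMap S h'' :=
  ((isComposite_pathMap S h).trans (isComposite_pathMap S h')).unique hδ
    (isComposite_pathMap S h'')

lemma pathMap_naturality (α : S ⟶ T) {Δ Δ' : K.Simplex} (h : K.PathLE δ Δ Δ') :
    pathMap S h ≫ LinearData.Hom.app α Δ' = LinearData.Hom.app α Δ ≫ pathMap T h := by
  obtain ⟨g, hg, e⟩ := (isComposite_pathMap S h).exists_comm α
  rw [e, hg.unique hδ (isComposite_pathMap T h)]

end

end PathMap

end PerverseSheaves

end

noncomputable section

namespace PerverseSheaves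

open AbstractSimplicialComplex

open Topology

/-! ### Carriers in the barycentric subdivision -/

section Carrier

variable {V : Type u} {K : AbstractSimplicialComplex V}

/-- The set `s` is a superlevel set of `x`, for a positive level. The simplices cutting a point of
the realization are those whose barycenters span the open simplex of the subdivision around it. -/
def Cuts (x : V → ℝ) (s : Finset V) : Prop := ∀ v ∈ s, 0 < x v ∧ ∀ w ∉ s, x w < x v

lemma cuts_truncation_iff {x : V → ℝ} {m : ℝ} (hm : 0 ≤ m) {s : Finset V} :
    Cuts (fun v ↦ max (x v - m) 0) s ↔ Cuts x s ∧ ∀ v ∈ s, m < x v := by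
  simp only [Cuts, ← forall₂_and]
  refine forall₂_congr fun v _ ↦ ⟨fun ⟨_, _⟩ ↦ ?_, fun ⟨⟨_, _⟩, _⟩ ↦ ?_⟩
  · have hmv : m < x v := by grind
    exact ⟨⟨by linarith, fun w hw ↦ by grind⟩, hmv⟩
  · exact ⟨by grind, fun w hw ↦ by grind⟩

lemma cuts_iff_eq_or_cuts_truncation {x : V → ℝ} {m : ℝ} (hm : 0 < m) {s t : Finset V}
    (ht : ∀ v, v ∈ t ↔ 0 < x v) (hmin : ∀ v ∈ t, m ≤ x v) :
    Cuts x s ↔ s = t ∨ Cuts (fun v ↦ max (x v - m) 0) s := by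
  rw [cuts_truncation_iff hm.le]
  constructor
  · refine fun h ↦ or_iff_not_imp_right.mpr fun hs ↦ ?_
    obtain ⟨v, hv, hvm⟩ : ∃ v ∈ s, x v ≤ m := by grind
    refine Finset.Subset.antisymm (fun w hw ↦ (ht w).mpr (h w hw).1) fun w hw ↦ ?_
    by_contra hws
    exact ((h v hv).2 w hws).not_ge (hvm.trans (hmin w hw))
  · rintro (rfl | h)
    · exact fun v hv ↦ ⟨(ht v).mp hv, fun w hw ↦
        (not_lt.mp ((ht w).not.mp hw)).trans_lt ((ht v).mp hv)⟩
    · exact h.1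

lemma barycenter_of_mem {Δ : K.Simplex} {v : V} (h : v ∈ Δ.1) :
    Δ.barycenter v = (Δ.1.card : ℝ)⁻¹ :=
  Set.indicator_of_mem (Finset.mem_coe.mpr h) _

lemma barycenter_of_notMem {Δ : K.Simplex} {v : V} (h : v ∉ Δ.1) : Δ.barycenter v = 0 :=
  Set.indicator_of_notMem (Finset.mem_coe.not.mpr h) _

lemma barycenter_pos {Δ : K.Simplex} {v : V} (h : v ∈ Δ.1) : 0 < Δ.barycenter v := by
  rw [barycenter_of_mem h]
  have := (simplex_nonempty Δ).card_pos
  positivity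

lemma barycenter_nonneg (Δ : K.Simplex) (v : V) : 0 ≤ Δ.barycenter v :=
  Set.indicator_nonneg (fun _ _ ↦ by positivity) v

lemma barycenter_le_barycenter {Δ : K.Simplex} {u v : V} (h : u ∈ Δ.1 → v ∈ Δ.1) :
    Δ.barycenter u ≤ Δ.barycenter v := by
  by_cases hu : u ∈ Δ.1
  · rw [barycenter_of_mem hu, barycenter_of_mem (h hu)]
  · rw [barycenter_of_notMem hu]
    exact barycenter_nonneg Δ v

/-- The linear combination with weights `w` of the barycenters of the simplices in `c`. -/
def barycentricSum (c : Finset K.Simplex) (w : K.Simplex → ℝ) : V → ℝ :=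
  ∑ Δ ∈ c, w Δ • Δ.barycenter

lemma barycentricSum_apply (c : Finset K.Simplex) (w : K.Simplex → ℝ) (v : V) :
    barycentricSum c w v = ∑ Δ ∈ c, w Δ * Δ.barycenter v := by
  simp only [barycentricSum, Finset.sum_apply, Pi.smul_apply, smul_eq_mul]

lemma exists_max_of_isFlag {c : Finset K.Simplex} (hc : K.IsFlag c) :
    ∃ D ∈ c, ∀ Δ ∈ c, Δ.1 ⊆ D.1 := by
  obtain ⟨D, hD, hmax⟩ := c.exists_max_image (fun D ↦ D.dim) hc.1
  exact ⟨D, hD, fun Δ hΔ ↦ subset_of_incident (hc.2 Δ hΔ D hD) (hmax Δ hΔ)⟩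

section

variable {c : Finset K.Simplex} {w : K.Simplex → ℝ}

lemma exists_mem_of_barycentricSum_pos {v : V} (h : 0 < barycentricSum c w v) :
    ∃ D ∈ c, v ∈ D.1 := by
  by_contra! hcon
  refine h.ne' ((barycentricSum_apply c w v).trans (Finset.sum_eq_zero fun D hD ↦ ?_))
  rw [barycenter_of_notMem (hcon D hD), mul_zero]

lemma exists_notMem_of_barycentricSum_lt (hw : ∀ Δ ∈ c, 0 < w Δ) {u v : V}
    (h : barycentricSum c w u < barycentricSum c w v) : ∃ D ∈ c, v ∈ D.1 ∧ u ∉ D.1 := by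
  by_contra! hcon
  refine h.not_ge ?_
  rw [barycentricSum_apply, barycentricSum_apply]
  exact Finset.sum_le_sum fun E hE ↦ mul_le_mul_of_nonneg_left
    (barycenter_le_barycenter (hcon E hE)) (hw E hE).le

variable (hc : K.IsFlag c) (hw : ∀ Δ ∈ c, 0 < w Δ)
include hc hw

lemma cuts_barycentricSum_of_mem {Δ : K.Simplex} (hΔ : Δ ∈ c) :
    Cuts (barycentricSum c w) Δ.1 := by
  refine fun v hv ↦ ⟨?_, fun u hu ↦ ?_⟩
  · rw [barycentricSum_apply]
    exact Finset.sum_pos' (fun D hD ↦ mul_nonneg (hw D hD).le (barycenter_nonneg D v))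
      ⟨Δ, hΔ, mul_pos (hw Δ hΔ) (barycenter_pos hv)⟩
  · rw [barycentricSum_apply, barycentricSum_apply]
    refine Finset.sum_lt_sum (fun D hD ↦ ?_) ⟨Δ, hΔ, ?_⟩
    · refine mul_le_mul_of_nonneg_left (barycenter_le_barycenter fun huD ↦ ?_) (hw D hD).le
      exact (hc.2 Δ hΔ D hD).elim (fun h ↦ h hv) fun h ↦ absurd (h huD) hu
    · rw [barycenter_of_notMem hu, mul_zero]
      exact mul_pos (hw Δ hΔ) (barycenter_pos hv)

lemma cuts_barycentricSum_iff {Δ : K.Simplex} : Cuts (barycentricSum c w) Δ.1 ↔ Δ ∈ c := by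
  classical
  refine ⟨fun h ↦ ?_, cuts_barycentricSum_of_mem hc hw⟩
  -- `Δ` is the smallest member of `c` containing a vertex `v` of `Δ` with least coordinate
  obtain ⟨v, hv, hmin⟩ := Δ.1.exists_min_image (barycentricSum c w) (simplex_nonempty Δ)
  obtain ⟨D₀, hD₀, hvD₀⟩ := exists_mem_of_barycentricSum_pos (h v hv).1
  obtain ⟨D, hD, hDmin⟩ := (c.filter fun D ↦ v ∈ D.1).exists_min_image (fun D ↦ D.dim)
    ⟨D₀, Finset.mem_filter.mpr ⟨hD₀, hvD₀⟩⟩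
  simp only [Finset.mem_filter, and_imp] at hD hDmin
  have hΔD : Δ.1 ⊆ D.1 := fun u hu ↦ by
    by_contra huD
    exact ((cuts_barycentricSum_of_mem hc hw hD.1 v hD.2).2 u huD).not_ge (hmin u hu)
  have hDΔ : D.1 ⊆ Δ.1 := fun u hu ↦ by
    by_contra huΔ
    obtain ⟨D', hD', hvD', huD'⟩ := exists_notMem_of_barycentricSum_lt hw ((h v hv).2 u huΔ)
    exact huD' (subset_of_incident (hc.2 D hD.1 D' hD') (hDmin D' hD' hvD') hu)
  rw [show Δ = D from Subtype.ext (hΔD.antisymm hDΔ)]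
  exact hD.1

end

variable [Fintype V]

lemma sum_barycenter (Δ : K.Simplex) : ∑ v, Δ.barycenter v = 1 := by
  classical
  have h := (simplex_nonempty Δ).card_pos
  simp only [Simplex.barycenter, Set.indicator_apply, Finset.mem_coe]
  rw [Finset.sum_ite_mem, Finset.univ_inter, Finset.sum_const, nsmul_eq_mul]
  field_simp

lemma sum_barycentricSum (c : Finset K.Simplex) (w : K.Simplex → ℝ) :
    ∑ v, barycentricSum c w v = ∑ Δ ∈ c, w Δ := by
  simp only [barycentricSum_apply]
  rw [Finset.sum_comm]
  exact Finset.sum_congr rfl fun Δ _ ↦ by rw [← Finset.mul_sum, sum_barycenter, mul_one]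

lemma barycentricSum_mem_realization {c : Finset K.Simplex} (hc : K.IsFlag c)
    {w : K.Simplex → ℝ} (hw : ∀ Δ ∈ c, 0 < w Δ) (hsum : ∑ Δ ∈ c, w Δ = 1) :
    barycentricSum c w ∈ K.realization := by
  have hnonneg (v : V) : 0 ≤ barycentricSum c w v := by
    rw [barycentricSum_apply]
    exact Finset.sum_nonneg fun D hD ↦ mul_nonneg (hw D hD).le (barycenter_nonneg D v)
  refine ⟨hnonneg, by rw [sum_barycentricSum, hsum], ?_⟩
  obtain ⟨D, hD, hmax⟩ := exists_max_of_isFlag hc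
  refine ⟨D.1, D.2, Set.ext fun v ↦ ?_⟩
  rw [Finset.mem_coe, Function.mem_support, ← (hnonneg v).lt_iff_ne']
  refine ⟨fun h ↦ (cuts_barycentricSum_of_mem hc hw hD v h).1, fun h ↦ ?_⟩
  obtain ⟨E, hE, hv⟩ := exists_mem_of_barycentricSum_pos h
  exact hmax E hE hv

open Classical in
/-- The simplices cutting `x`. -/
def carrierOf (K : AbstractSimplicialComplex V) (x : V → ℝ) : Finset K.Simplex :=
  Finset.univ.filter fun Δ ↦ Cuts x Δ.1

lemma mem_carrierOf {x : V → ℝ} {Δ : K.Simplex} : Δ ∈ carrierOf K x ↔ Cuts x Δ.1 := by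
  simp only [carrierOf, Finset.mem_filter, Finset.mem_univ, true_and]

lemma carrierOf_barycentricSum {c : Finset K.Simplex} (hc : K.IsFlag c) {w : K.Simplex → ℝ}
    (hw : ∀ Δ ∈ c, 0 < w Δ) : carrierOf K (barycentricSum c w) = c :=
  Finset.ext fun _ ↦ mem_carrierOf.trans (cuts_barycentricSum_iff hc hw)

lemma exists_weights_of_truncation {x : V → ℝ} (h0 : ∀ v, 0 ≤ x v) {T : K.Simplex}
    (hT : ∀ v, v ∈ T.1 ↔ 0 < x v) {u : V} (hu : u ∈ T.1) (hmin : ∀ v ∈ T.1, x u ≤ x v)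
    {x' : V → ℝ} (hx' : x' = fun v ↦ max (x v - x u) 0)
    {w' : K.Simplex → ℝ} (hw' : ∀ Δ ∈ carrierOf K x', 0 < w' Δ)
    (hsum : x' = barycentricSum (carrierOf K x') w') :
    ∃ w : K.Simplex → ℝ, (∀ Δ ∈ carrierOf K x, 0 < w Δ) ∧
      x = barycentricSum (carrierOf K x) w := by
  classical
  have hm := (hT u).mp hu
  have hTx' : T ∉ carrierOf K x' := fun h ↦ by
    rw [mem_carrierOf, hx', cuts_truncation_iff hm.le] at h
    exact (h.2 u hu).false
  have hins : carrierOf K x = insert T (carrierOf K x') := Finset.ext fun Δ ↦ by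
    rw [Finset.mem_insert, mem_carrierOf, mem_carrierOf, hx', ← Subtype.coe_inj,
      cuts_iff_eq_or_cuts_truncation hm hT hmin]
  have hcard : 0 < (T.1.card : ℝ) := Nat.cast_pos.mpr (simplex_nonempty T).card_pos
  have hw {Δ : K.Simplex} (hΔ : Δ ∈ carrierOf K x') :
      Function.update w' T (x u * T.1.card) Δ = w' Δ :=
    Function.update_of_ne (ne_of_mem_of_not_mem hΔ hTx') _ _
  refine ⟨Function.update w' T (x u * T.1.card), ?_, ?_⟩
  · rw [hins, Finset.forall_mem_insert, Function.update_self]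
    exact ⟨mul_pos hm hcard, fun Δ hΔ ↦ (hw' Δ hΔ).trans_eq (hw hΔ).symm⟩
  · have key : x = (x u * T.1.card) • T.barycenter + x' := by
      ext v
      rw [hx', Pi.add_apply, Pi.smul_apply, smul_eq_mul]
      by_cases hv : v ∈ T.1
      · rw [barycenter_of_mem hv, max_eq_left (by linarith [hmin v hv]), mul_assoc,
          mul_inv_cancel₀ hcard.ne']
        ring
      · have hxv : x v = 0 := le_antisymm (not_lt.mp ((hT v).not.mp hv)) (h0 v)
        rw [barycenter_of_notMem hv, hxv, max_eq_right (by linarith), mul_zero, add_zero]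
    rw [hins, barycentricSum, Finset.sum_insert hTx', Function.update_self,
      Finset.sum_congr rfl fun Δ hΔ ↦ by rw [hw hΔ]]
    exact key.trans (congrArg _ hsum)

-- Subtract the least positive coordinate `m` on the support `T`; this splits off the barycenter
-- of `T` with weight `m * |T|` and leaves a point of smaller support.
lemma exists_barycentricSum_eq (x : V → ℝ) (h0 : ∀ v, 0 ≤ x v) {Δ₀ : K.Simplex}
    (hsupp : ∀ v, 0 < x v → v ∈ Δ₀.1) :
    ∃ w : K.Simplex → ℝ, (∀ Δ ∈ carrierOf K x, 0 < w Δ) ∧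
      x = barycentricSum (carrierOf K x) w := by
  classical
  induction hn : (Finset.univ.filter fun v ↦ 0 < x v).card using Nat.strong_induction_on
    generalizing x with
  | _ n ih =>
  rcases (Finset.univ.filter fun v ↦ 0 < x v).eq_empty_or_nonempty with hempty | hne
  · have hx (v : V) : ¬ 0 < x v := by simpa using Finset.ext_iff.mp hempty v
    have hcar : carrierOf K x = ∅ := Finset.eq_empty_of_forall_notMem fun Δ hΔ ↦ by
      obtain ⟨v, hv⟩ := simplex_nonempty Δ
      exact hx v (mem_carrierOf.mp hΔ v hv).1
    refine ⟨fun _ ↦ 1, fun _ _ ↦ one_pos, funext fun v ↦ ?_⟩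
    rw [hcar, barycentricSum_apply, Finset.sum_empty]
    exact le_antisymm (not_lt.mp (hx v)) (h0 v)
  · obtain ⟨T, hT⟩ := exists_simplex_eq (Δ := Δ₀) hne fun v hv ↦
      hsupp v (Finset.mem_filter.mp hv).2
    have memT (v : V) : v ∈ T.1 ↔ 0 < x v := by simp [hT]
    obtain ⟨u, hu, hmin⟩ := T.1.exists_min_image x (simplex_nonempty T)
    have hm := (memT u).mp hu
    have hpos {v : V} (hv : 0 < max (x v - x u) 0) : x u < x v := by grind
    have hlt : (Finset.univ.filter fun v ↦ 0 < max (x v - x u) 0).card < n :=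
      hn ▸ Finset.card_lt_card ((Finset.ssubset_iff_of_subset (Finset.monotone_filter_right _
        fun v _ hv ↦ hm.trans (hpos hv))).mpr ⟨u, by simpa using hm, by simp⟩)
    obtain ⟨w', hw', hsum⟩ := ih _ hlt (fun v ↦ max (x v - x u) 0) (fun v ↦ le_max_right _ _)
      (fun v hv ↦ hsupp v (hm.trans (hpos hv))) rfl
    exact exists_weights_of_truncation h0 memT hu hmin rfl hw' hsum

/-- The simplices whose barycenters span the open simplex of the barycentric subdivision
containing `x`. -/
abbrev carrier (x : K.space) : Finset K.Simplex := carrierOf K x.1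

lemma exists_weights (x : K.space) : ∃ w : K.Simplex → ℝ, (∀ Δ ∈ carrier x, 0 < w Δ) ∧
    ∑ Δ ∈ carrier x, w Δ = 1 ∧ x.1 = barycentricSum (carrier x) w := by
  obtain ⟨h0, h1, s, hs, hsupp⟩ := x.2
  obtain ⟨w, hw, hx⟩ := exists_barycentricSum_eq (K := K) (Δ₀ := ⟨s, hs⟩) x.1 h0 fun v hv ↦
    Finset.mem_coe.mp (hsupp ▸ hv.ne')
  refine ⟨w, hw, ?_, hx⟩
  rw [← sum_barycentricSum, ← hx, h1]

open Classical in
lemma exists_weights_of_subset {x : K.space} {c : Finset K.Simplex} (h : carrier x ⊆ c) :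
    ∃ w : K.Simplex → ℝ, (∀ Δ, 0 ≤ w Δ) ∧ ∑ Δ ∈ c, w Δ = 1 ∧ x.1 = barycentricSum c w := by
  obtain ⟨w, hw, hsum, hx⟩ := exists_weights x
  refine ⟨fun Δ ↦ if Δ ∈ carrier x then w Δ else 0, fun Δ ↦ ?_, ?_, ?_⟩
  · change 0 ≤ ite _ _ _
    split_ifs with hΔ
    exacts [(hw Δ hΔ).le, le_rfl]
  · rw [Finset.sum_ite_mem, Finset.inter_eq_right.mpr h, hsum]
  · simp only [barycentricSum, ite_smul, zero_smul]
    rw [Finset.sum_ite_mem, Finset.inter_eq_right.mpr h]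
    exact hx

lemma isFlag_carrier (x : K.space) : K.IsFlag (carrier x) := by
  obtain ⟨w, -, hw, -⟩ := exists_weights x
  refine ⟨Finset.nonempty_of_sum_ne_zero (hw.trans_ne one_ne_zero), fun Δ hΔ Δ' hΔ' ↦ ?_⟩
  by_contra h
  obtain ⟨h₁, h₂⟩ := not_or.mp h
  obtain ⟨v, hv, hv'⟩ := Finset.not_subset.mp h₁
  obtain ⟨u, hu, hu'⟩ := Finset.not_subset.mp h₂
  exact lt_asymm ((mem_carrierOf.mp hΔ v hv).2 u hu') ((mem_carrierOf.mp hΔ' u hu).2 v hv')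

lemma mem_openSubdivisionSimplex_iff {c : Finset K.Simplex} (hc : K.IsFlag c) {x : K.space} :
    x ∈ K.openSubdivisionSimplex c ↔ carrier x = c := by
  constructor
  · rintro ⟨w, hw, -, hx⟩
    exact (congrArg (carrierOf K) hx).trans (carrierOf_barycentricSum hc hw)
  · rintro rfl
    exact exists_weights x

lemma eventually_carrier_subset (x : K.space) : ∀ᶠ y in 𝓝 x, carrier x ⊆ carrier y := by
  have hcont (v : V) : Continuous fun y : K.space ↦ y.1 v :=
    (continuous_apply v).comp continuous_subtype_val
  have hmem : ∀ Δ ∈ carrier x, ∀ᶠ y in 𝓝 x, Δ ∈ carrier y := fun Δ hΔ ↦ by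
    simp only [mem_carrierOf, Cuts] at hΔ ⊢
    refine (Filter.eventually_all_finset _).mpr fun v hv ↦ ?_
    have hlt (w : V) : ∀ᶠ y in 𝓝 x, w ∉ Δ.1 → y.1 w < y.1 v := by
      by_cases hw : w ∈ Δ.1
      · exact .of_forall fun _ h ↦ absurd hw h
      · exact ((hcont w).continuousAt.eventually_lt (hcont v).continuousAt
          ((hΔ v hv).2 w hw)).mono fun _ h _ ↦ h
    exact (continuousAt_const.eventually_lt (hcont v).continuousAt (hΔ v hv).1).and
      (Filter.eventually_all.mpr hlt)
  exact (Filter.eventually_all_finset _).mpr hmem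

lemma exists_carrier_eq {c : Finset K.Simplex} (hc : K.IsFlag c) :
    ∃ x : K.space, carrier x = c := by
  have hcard : (0 : ℝ) < c.card := Nat.cast_pos.mpr hc.1.card_pos
  have hw : ∀ Δ ∈ c, 0 < (fun _ : K.Simplex ↦ (c.card : ℝ)⁻¹) Δ := fun _ _ ↦ inv_pos.mpr hcard
  exact ⟨⟨_, barycentricSum_mem_realization hc hw (by simp [hcard.ne'])⟩,
    carrierOf_barycentricSum hc hw⟩

lemma exists_weights_mix {x y : K.space} (h : carrier x ⊆ carrier y) {t : ℝ} (ht : 0 < t)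
    (ht1 : t ≤ 1) : ∃ w : K.Simplex → ℝ, (∀ Δ ∈ carrier y, 0 < w Δ) ∧
      ∑ Δ ∈ carrier y, w Δ = 1 ∧ (1 - t) • x.1 + t • y.1 = barycentricSum (carrier y) w := by
  obtain ⟨w, hw, hsum, hx⟩ := exists_weights_of_subset h
  obtain ⟨w', hw', hsum', hy⟩ := exists_weights y
  refine ⟨fun Δ ↦ (1 - t) * w Δ + t * w' Δ, fun Δ hΔ ↦ add_pos_of_nonneg_of_pos
    (mul_nonneg (sub_nonneg.mpr ht1) (hw Δ)) (mul_pos ht (hw' Δ hΔ)), ?_, ?_⟩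
  · rw [Finset.sum_add_distrib, ← Finset.mul_sum, ← Finset.mul_sum, hsum, hsum']
    ring
  · simp only [barycentricSum, add_smul, mul_smul, Finset.sum_add_distrib, ← Finset.smul_sum]
    exact congrArg₂ (fun a b ↦ (1 - t) • a + t • b) hx hy

/-- The point `(1 - t) x + t y` of the segment from `x` to a point `y` whose carrier is larger. -/
def mix (x y : K.space) (h : carrier x ⊆ carrier y) (t : unitInterval) : K.space :=
  ⟨(1 - (t : ℝ)) • x.1 + (t : ℝ) • y.1, by
    rcases eq_or_lt_of_le t.2.1 with h0 | h0
    · simp only [← h0, sub_zero, one_smul, zero_smul, add_zero, Subtype.coe_prop]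
    · obtain ⟨w, hw, hsum, e⟩ := exists_weights_mix h h0 t.2.2
      exact e ▸ barycentricSum_mem_realization (isFlag_carrier y) hw hsum⟩

section

variable {x y : K.space} (h : carrier x ⊆ carrier y)

lemma mix_zero : mix x y h 0 = x :=
  Subtype.ext (by simp [mix])

lemma mix_one : mix x y h 1 = y :=
  Subtype.ext (by simp [mix])

lemma carrier_mix {t : unitInterval} (ht : 0 < t) : carrier (mix x y h t) = carrier y := by
  obtain ⟨w, hw, -, e⟩ := exists_weights_mix h ht t.2.2
  exact (congrArg (carrierOf K) e).trans (carrierOf_barycentricSum (isFlag_carrier y) hw)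

lemma dist_mix_le (t : unitInterval) : dist (mix x y h t) x ≤ dist y x := by
  change dist ((1 - (t : ℝ)) • x.1 + (t : ℝ) • y.1) x.1 ≤ dist y.1 x.1
  rw [dist_eq_norm, dist_eq_norm, show (1 - (t : ℝ)) • x.1 + (t : ℝ) • y.1 - x.1 =
    (t : ℝ) • (y.1 - x.1) by module, norm_smul, Real.norm_of_nonneg t.2.1]
  exact mul_le_of_le_one_left (norm_nonneg _) t.2.2

end

lemma continuous_mix {Y : Type*} [TopologicalSpace Y] {f g : Y → K.space} {t : Y → unitInterval}
    (h : ∀ y, carrier (f y) ⊆ carrier (g y)) (hf : Continuous f) (hg : Continuous g)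
    (ht : Continuous t) : Continuous fun y ↦ mix (f y) (g y) (h y) (t y) := by
  unfold mix
  fun_prop

end Carrier

end PerverseSheaves

end

noncomputable section

namespace PerverseSheaves

open AbstractSimplicialComplex

open Topology

/-! ### The perverse stratification -/

section Flags

variable {V : Type u} {K : AbstractSimplicialComplex V}

lemma eq_of_mem_isFlag_of_rank_eq {δ : ℕ → ℤ} (hδ : IsPerversity δ) {c : Finset K.Simplex}
    (hc : K.IsFlag c) {Δ Δ' : K.Simplex} (h : Δ ∈ c) (h' : Δ' ∈ c) (hr : δ Δ.dim = δ Δ'.dim) :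
    Δ = Δ' := by
  have hdim := hδ.injective hr
  exact eq_of_subset_of_dim_le (subset_of_incident (hc.2 Δ h Δ' h') hdim.le) hdim.ge

lemma isFlag_singleton (Δ : K.Simplex) : K.IsFlag {Δ} :=
  ⟨Finset.singleton_nonempty _, by
    simp only [Finset.mem_singleton]
    rintro _ rfl _ rfl
    exact Or.inl subset_rfl⟩

open Classical in
lemma isFlag_insert {c : Finset K.Simplex} (hc : K.IsFlag c) {Δ : K.Simplex}
    (h : ∀ Δ' ∈ c, Δ.Incident Δ') : K.IsFlag (insert Δ c) :=
  ⟨Finset.insert_nonempty _ _, by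
    simp only [Finset.mem_insert]
    rintro _ (rfl | h₁) _ (rfl | h₂)
    exacts [Or.inl subset_rfl, h _ h₂, incident_symm (h _ h₁), hc.2 _ h₁ _ h₂]⟩

open Classical in
lemma isFlag_pair {Δ Δ' : K.Simplex} (h : Δ.Incident Δ') : K.IsFlag {Δ, Δ'} :=
  isFlag_insert (isFlag_singleton Δ') fun _ hD ↦ Finset.mem_singleton.mp hD ▸ h

end Flags

variable {V : Type u} [Fintype V] {K : AbstractSimplicialComplex V}

section Stratification

variable (δ : ℕ → ℤ)

lemma exists_pole (x : K.space) : ∃ Δ ∈ carrier x, ∀ Δ' ∈ carrier x, δ Δ.dim ≤ δ Δ'.dim :=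
  (carrier x).exists_min_image (fun Δ ↦ δ Δ.dim) (isFlag_carrier x).1

/-- The simplex `Δ` such that `x` lies in the `(-δ)`-perverse simplex of `Δ`: the one of least
rank in the carrier of `x`. -/
def pole (x : K.space) : K.Simplex := (exists_pole δ x).choose

lemma pole_mem (x : K.space) : pole δ x ∈ carrier x := (exists_pole δ x).choose_spec.1

lemma pole_le (x : K.space) {Δ : K.Simplex} (h : Δ ∈ carrier x) : δ (pole δ x).dim ≤ δ Δ.dim :=
  (exists_pole δ x).choose_spec.2 Δ h

variable {δ} (hδ : IsPerversity δ)
include hδ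

lemma pole_eq_iff {x : K.space} {Δ : K.Simplex} :
    pole δ x = Δ ↔ Δ ∈ carrier x ∧ ∀ Δ' ∈ carrier x, δ Δ.dim ≤ δ Δ'.dim := by
  constructor
  · rintro rfl
    exact ⟨pole_mem δ x, fun Δ' h ↦ pole_le δ x h⟩
  · rintro ⟨hmem, hle⟩
    exact eq_of_mem_isFlag_of_rank_eq hδ (isFlag_carrier x) (pole_mem δ x) hmem
      ((pole_le δ x hmem).antisymm (hle _ (pole_mem δ x)))

lemma pole_congr {x y : K.space} (h : carrier x = carrier y) : pole δ x = pole δ y := by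
  rw [pole_eq_iff hδ, h, ← pole_eq_iff hδ]

lemma mem_perverseSimplex_iff {x : K.space} {Δ : K.Simplex} :
    x ∈ K.perverseSimplex (fun k ↦ -δ k) Δ ↔ pole δ x = Δ := by
  rw [pole_eq_iff hδ]
  simp only [perverseSimplex, Set.mem_iUnion, Set.mem_ofPred_eq, exists_prop, neg_le_neg_iff]
  constructor
  · rintro ⟨c, ⟨hc, hmem, hle⟩, hx⟩
    rw [(mem_openSubdivisionSimplex_iff hc).mp hx]
    exact ⟨hmem, hle⟩
  · rintro ⟨hmem, hle⟩
    exact ⟨carrier x, ⟨isFlag_carrier x, hmem, hle⟩,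
      (mem_openSubdivisionSimplex_iff (isFlag_carrier x)).mpr rfl⟩

lemma pathLE_pole {x y : K.space} (h : carrier x ⊆ carrier y) :
    K.PathLE δ (pole δ x) (pole δ y) :=
  pathLE_of_incident hδ ((isFlag_carrier y).2 _ (h (pole_mem δ x)) _ (pole_mem δ y))
    (pole_le δ y (h (pole_mem δ x)))

lemma eventually_pathLE_pole (x : K.space) : ∀ᶠ y in 𝓝 x, K.PathLE δ (pole δ x) (pole δ y) := by
  filter_upwards [eventually_carrier_subset x] with y h using pathLE_pole hδ h

lemma mem_perverseStar_iff {x : K.space} {Δ : K.Simplex} :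
    x ∈ K.perverseStar δ Δ ↔ K.PathLE δ Δ (pole δ x) := by
  have hunion : (⋃ Δ' ∈ {Δ' | K.PathLE δ Δ Δ'}, K.perverseSimplex (fun k ↦ -δ k) Δ') =
      {x : K.space | K.PathLE δ Δ (pole δ x)} := by
    ext y
    simp only [Set.mem_iUnion, Set.mem_ofPred_eq, exists_prop, mem_perverseSimplex_iff hδ,
      exists_eq_right']
  have hopen : IsOpen {x : K.space | K.PathLE δ Δ (pole δ x)} := by
    rw [isOpen_iff_mem_nhds]
    intro y hy
    filter_upwards [eventually_pathLE_pole hδ y] with z hz using Relation.ReflTransGen.trans hy hz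
  change x ∈ interior _ ↔ _
  rw [hunion, hopen.interior_eq]
  rfl

end Stratification

section Centers

/-- The barycenter of a simplex, as a point of the realization. -/
def center (Δ : K.Simplex) : K.space := (exists_carrier_eq (isFlag_singleton Δ)).choose

lemma carrier_center (Δ : K.Simplex) : carrier (center Δ) = {Δ} :=
  (exists_carrier_eq (isFlag_singleton Δ)).choose_spec

lemma carrier_center_subset {Δ : K.Simplex} {x : K.space} (h : Δ ∈ carrier x) :
    carrier (center Δ) ⊆ carrier x := by
  rwa [carrier_center, Finset.singleton_subset_iff]

open Classical in
/-- A point in the open segment between the barycenters of two incident simplices. -/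
def pairCenter {Δ Δ' : K.Simplex} (h : Δ.Incident Δ') : K.space :=
  (exists_carrier_eq (isFlag_pair h)).choose

section

variable {Δ Δ' : K.Simplex} (h : Δ.Incident Δ')

open Classical in
lemma carrier_pairCenter : carrier (pairCenter h) = {Δ, Δ'} :=
  (exists_carrier_eq (isFlag_pair h)).choose_spec

lemma carrier_center_subset_pairCenter : carrier (center Δ) ⊆ carrier (pairCenter h) :=
  carrier_center_subset (by simp [carrier_pairCenter])

lemma carrier_pairCenter_subset {x : K.space} (hx : Δ ∈ carrier x) (hx' : Δ' ∈ carrier x) :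
    carrier (pairCenter h) ⊆ carrier x := by
  simp [carrier_pairCenter, Finset.insert_subset_iff, hx, hx']

end

variable {δ : ℕ → ℤ} (hδ : IsPerversity δ)
include hδ

lemma pole_center (Δ : K.Simplex) : pole δ (center Δ) = Δ := by
  simp [pole_eq_iff hδ, carrier_center]

lemma pole_pairCenter {Δ Δ' : K.Simplex} (h : Δ.Incident Δ') (hr : δ Δ'.dim ≤ δ Δ.dim) :
    pole δ (pairCenter h) = Δ' := by
  simp [pole_eq_iff hδ, carrier_pairCenter, hr]

end Centers

section Segments

lemma continuous_mix_segment {x y : K.space} (h : carrier x ⊆ carrier y) :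
    Continuous (mix x y h) :=
  continuous_mix (fun _ ↦ h) continuous_const continuous_const continuous_id

lemma eventually_mix_mem {x y : K.space} (h : carrier x ⊆ carrier y) {U : Opens K.space}
    (hx : x ∈ U) : ∀ᶠ t in 𝓝 0, mix x y h t ∈ U :=
  (continuous_mix_segment h).continuousAt.eventually
    (U.2.mem_nhds ((mix_zero h).symm ▸ hx))

lemma carrier_mix_subset_carrier_mix {x y x' y' : K.space} (hxy : carrier x ⊆ carrier y)
    (hx : carrier x ⊆ carrier x') (hy : carrier y ⊆ carrier y') (hxy' : carrier x' ⊆ carrier y')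
    (t : unitInterval) : carrier (mix x x' hx t) ⊆ carrier (mix y y' hy t) := by
  obtain rfl | ht := (unitInterval.nonneg' : 0 ≤ t).eq_or_lt
  · rwa [mix_zero, mix_zero]
  · rwa [carrier_mix hx ht, carrier_mix hy ht]

variable {δ : ℕ → ℤ} (hδ : IsPerversity δ)
include hδ

lemma pole_mix {x y : K.space} (h : carrier x ⊆ carrier y) {t : unitInterval} (ht : 0 < t) :
    pole δ (mix x y h t) = pole δ y :=
  pole_congr hδ (carrier_mix h ht)

lemma pole_mix_eq {x y : K.space} (h : carrier x ⊆ carrier y) {Δ : K.Simplex}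
    (hx : pole δ x = Δ) (hy : pole δ y = Δ) (t : unitInterval) : pole δ (mix x y h t) = Δ := by
  obtain rfl | ht := (unitInterval.nonneg' : 0 ≤ t).eq_or_lt
  · rwa [mix_zero]
  · rwa [pole_mix hδ h ht]

lemma mix_mem_perverseStar {x y : K.space} (h : carrier x ⊆ carrier y) {Δ : K.Simplex}
    (hx : x ∈ K.perverseStar δ Δ) (t : unitInterval) : mix x y h t ∈ K.perverseStar δ Δ := by
  rw [mem_perverseStar_iff hδ] at hx ⊢
  obtain rfl | ht := (unitInterval.nonneg' : 0 ≤ t).eq_or_lt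
  · rwa [mix_zero]
  · rw [pole_mix hδ h ht]
    exact hx.trans (pathLE_pole hδ h)

end Segments

end PerverseSheaves

end

noncomputable section

namespace PerverseSheaves

open AbstractSimplicialComplex

open Topology

variable {F : Type u} [Field F] {V : Type u} [Fintype V] {K : AbstractSimplicialComplex V}
  {δ : ℕ → ℤ}

/-! ### Transport between the strata of a constructible sheaf -/

/-- Identifications of the stalks of `A` along each stratum with a fixed vector space, such that
the values of sections are locally constant along the strata. -/
structure StratumValues (δ : ℕ → ℤ) (A : TopCat.Sheaf (ModuleCat.{u} F) K.space)
    (W : K.Simplex → ModuleCat.{u} F) where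
  val : ∀ {Δ : K.Simplex} {x : K.space}, pole δ x = Δ → A.presheaf.stalk x ≃ₗ[F] W Δ
  eventually_eq : ∀ {U : Opens K.space} (s : A.presheaf.obj (op U)) {Δ : K.Simplex} {x : K.space}
    (hx : x ∈ U) (h : pole δ x = Δ), ∀ᶠ y in 𝓝 x, ∀ (hy : y ∈ U) (h' : pole δ y = Δ),
      val h' (A.presheaf.germ U y hy s) = val h (A.presheaf.germ U x hx s)

lemma isPerverselyConstructible_iff (hδ : IsPerversity δ)
    (A : TopCat.Sheaf (ModuleCat.{u} F) K.space) :
    K.IsPerverselyConstructible F (fun k ↦ -δ k) A ↔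
      ∃ W : K.Simplex → ModuleCat.{u} F, (∀ Δ, Module.Finite F (W Δ)) ∧
        Nonempty (StratumValues δ A W) := by
  constructor
  · intro hA
    choose W hW φ using hA
    have τ Δ := ((nonempty_stalkTrivialization_iff (W Δ)).mpr (φ Δ)).some
    refine ⟨W, hW, ⟨⟨fun {Δ x} h ↦
      ((τ Δ).iso ⟨x, (mem_perverseSimplex_iff hδ).mpr h⟩).toLinearEquiv, ?_⟩⟩⟩
    intro U s Δ x hx h
    have hev := (τ Δ).eventually_eq U s ⟨x, (mem_perverseSimplex_iff hδ).mpr h⟩ hx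
    rw [nhds_subtype, Filter.eventually_comap] at hev
    filter_upwards [hev] with y hy hyU h'
    exact hy ⟨y, (mem_perverseSimplex_iff hδ).mpr h'⟩ rfl hyU
  · rintro ⟨W, hW, ⟨v⟩⟩ Δ
    refine ⟨W Δ, hW Δ, (nonempty_stalkTrivialization_iff (W Δ)).mp
      ⟨⟨fun z ↦ (v.val ((mem_perverseSimplex_iff hδ).mp z.2)).toModuleIso, fun U s z hz ↦ ?_⟩⟩⟩
    filter_upwards [continuous_subtype_val.continuousAt.eventually
      (v.eventually_eq s hz ((mem_perverseSimplex_iff hδ).mp z.2))] with z' h hz'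
    exact h hz' ((mem_perverseSimplex_iff hδ).mp z'.2)

omit [Fintype V] in
open Classical in
lemma isFlag_triple {Δ₁ Δ₂ Δ₃ : K.Simplex} (h₁₂ : Δ₁.Incident Δ₂) (h₂₃ : Δ₂.Incident Δ₃)
    (h₁₃ : Δ₁.Incident Δ₃) : K.IsFlag {Δ₁, Δ₂, Δ₃} :=
  isFlag_insert (isFlag_pair h₂₃) (by simp [h₁₂, h₁₃])

lemma exists_pos_forall_le {P : unitInterval → Prop} (h : ∀ᶠ t in 𝓝 0, P t) :
    ∃ t₁ : unitInterval, 0 < t₁ ∧ ∀ t ≤ t₁, P t := by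
  obtain ⟨u, hu, hP⟩ := exists_Ico_subset_of_mem_nhds h ⟨1, zero_lt_one⟩
  obtain ⟨t₁, h0, h1⟩ := exists_between hu
  exact ⟨t₁, h0, fun t ht ↦ hP ⟨unitInterval.nonneg', ht.trans_lt h1⟩⟩

lemma exists_pos_forall_mix_mem {U : Opens K.space} {x y : K.space} (hx : x ∈ U)
    (hxy : carrier x ⊆ carrier y) :
    ∃ t₁ : unitInterval, 0 < t₁ ∧ ∀ t ≤ t₁, mix x y hxy t ∈ U :=
  exists_pos_forall_le (eventually_mix_mem hxy hx)

namespace StratumValues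

variable {A : TopCat.Sheaf (ModuleCat.{u} F) K.space} {W : K.Simplex → ModuleCat.{u} F}
  (v : StratumValues δ A W)

section Value

variable {U U' : Opens K.space} {Δ : K.Simplex} {x y : K.space}

/-- The value of a section at a point. -/
def value (hx : x ∈ U) (h : pole δ x = Δ) : A.presheaf.obj (op U) →ₗ[F] W Δ :=
  (v.val h).toLinearMap ∘ₗ (A.presheaf.germ U x hx).hom

lemma value_congr (e : x = y) (hx : x ∈ U) (h : pole δ x = Δ) (hy : y ∈ U) (h' : pole δ y = Δ)
    (s : A.presheaf.obj (op U)) : v.value hx h s = v.value hy h' s := by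
  subst e
  rfl

lemma value_map (i : U' ⟶ U) (hx : x ∈ U) (hx' : x ∈ U') (h : pole δ x = Δ)
    (s : A.presheaf.obj (op U)) : v.value hx' h (A.presheaf.map i.op s) = v.value hx h s :=
  congrArg (v.val h) (A.presheaf.germ_res_apply i x hx' s)

lemma exists_value_eq (h : pole δ x = Δ) (a : W Δ) :
    ∃ (U : Opens K.space) (hx : x ∈ U) (s : A.presheaf.obj (op U)), v.value hx h s = a := by
  obtain ⟨U, hx, s, e⟩ := A.presheaf.exists_germ_eq ((v.val h).symm a)
  exact ⟨U, hx, s, (congrArg (v.val h) e).trans ((v.val h).apply_symm_apply a)⟩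

lemma exists_value_eq₂ (h : pole δ x = Δ) (a b : W Δ) :
    ∃ (U : Opens K.space) (hx : x ∈ U) (s t : A.presheaf.obj (op U)),
      v.value hx h s = a ∧ v.value hx h t = b := by
  obtain ⟨U₁, hx₁, s, rfl⟩ := v.exists_value_eq h a
  obtain ⟨U₂, hx₂, t, rfl⟩ := v.exists_value_eq h b
  exact ⟨U₁ ⊓ U₂, ⟨hx₁, hx₂⟩, A.presheaf.map (homOfLE inf_le_left).op s,
    A.presheaf.map (homOfLE inf_le_right).op t, v.value_map _ _ _ _ _, v.value_map _ _ _ _ _⟩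

lemma eventually_value_eq (hx : x ∈ U) (h : pole δ x = Δ) (s : A.presheaf.obj (op U)) :
    ∀ᶠ y in 𝓝 x, ∀ (hy : y ∈ U) (h' : pole δ y = Δ), v.value hy h' s = v.value hx h s :=
  v.eventually_eq s hx h

lemma eventually_value_eq_of_value_eq (hx : x ∈ U) (hx' : x ∈ U') (h : pole δ x = Δ)
    {s : A.presheaf.obj (op U)} {s' : A.presheaf.obj (op U')}
    (e : v.value hx h s = v.value hx' h s') :
    ∀ᶠ y in 𝓝 x, ∀ (hy : y ∈ U) (hy' : y ∈ U') {D : K.Simplex} (hD : pole δ y = D),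
      v.value hy hD s = v.value hy' hD s' := by
  obtain ⟨O, hO, i, j, e'⟩ := A.presheaf.germ_eq x hx hx' s s' ((v.val h).injective e)
  filter_upwards [O.2.mem_nhds hO] with y hyO hy hy' D hD
  rw [← v.value_map i hy hyO hD, ← v.value_map j hy' hyO hD, e']

lemma value_eq_of_preconnectedSpace {Y : Type*} [TopologicalSpace Y] [PreconnectedSpace Y]
    {f : Y → K.space} (hf : Continuous f) (hU : ∀ r, f r ∈ U) (hΔ : ∀ r, pole δ (f r) = Δ)
    (s : A.presheaf.obj (op U)) (r r' : Y) :
    v.value (hU r) (hΔ r) s = v.value (hU r') (hΔ r') s := by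
  refine IsLocallyConstant.apply_eq_of_preconnectedSpace
    (f := fun r ↦ v.value (hU r) (hΔ r) s) ?_ r r'
  rw [IsLocallyConstant.iff_eventually_eq]
  intro r
  filter_upwards [hf.continuousAt.eventually (v.eventually_value_eq (hU r) (hΔ r) s)] with r' h
  exact h (hU r') (hΔ r')

end Value

variable (hδ : IsPerversity δ)

section SegmentTransport

variable {x y : K.space} (hxy : carrier x ⊆ carrier y) {Δ₁ Δ₂ : K.Simplex} (h₁ : pole δ x = Δ₁)
  (h₂ : pole δ y = Δ₂)

lemma value_mix_eq {U : Opens K.space} {t₁ : unitInterval} (h0 : 0 < t₁)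
    (hU : ∀ t ≤ t₁, mix x y hxy t ∈ U) (s : A.presheaf.obj (op U)) {t : unitInterval}
    (ht : 0 < t) (hle : t ≤ t₁) :
    v.value (hU t₁ le_rfl) ((pole_mix hδ hxy h0).trans h₂) s =
      v.value (hU t hle) ((pole_mix hδ hxy ht).trans h₂) s :=
  have := Subtype.preconnectedSpace (isPreconnected_Ioc (a := 0) (b := t₁))
  v.value_eq_of_preconnectedSpace (Y := Set.Ioc 0 t₁) (f := fun t ↦ mix x y hxy t)
    ((continuous_mix_segment hxy).comp continuous_subtype_val) (fun t ↦ hU t t.2.2)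
    (fun t ↦ (pole_mix hδ hxy t.2.1).trans h₂) s ⟨t₁, h0, le_rfl⟩ ⟨t, ht, hle⟩

include h₁ in
lemma value_mix_eq_of_value_eq {U U' : Opens K.space} {s : A.presheaf.obj (op U)}
    {s' : A.presheaf.obj (op U')} (hx : x ∈ U) (hx' : x ∈ U')
    (e : v.value hx h₁ s = v.value hx' h₁ s') {t₁ t₂ : unitInterval} (ht₁ : 0 < t₁)
    (ht₂ : 0 < t₂) (hU : ∀ t ≤ t₁, mix x y hxy t ∈ U) (hU' : ∀ t ≤ t₂, mix x y hxy t ∈ U') :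
    v.value (hU t₁ le_rfl) ((pole_mix hδ hxy ht₁).trans h₂) s =
      v.value (hU' t₂ le_rfl) ((pole_mix hδ hxy ht₂).trans h₂) s' := by
  obtain ⟨O, hO, hOo, hxO⟩ := eventually_nhds_iff.mp
    (v.eventually_value_eq_of_value_eq hx hx' h₁ e)
  obtain ⟨t₃, ht₃, hO'⟩ := exists_pos_forall_mix_mem (U := ⟨O, hOo⟩) hxO hxy
  have ht : 0 < min (min t₁ t₂) t₃ := lt_min (lt_min ht₁ ht₂) ht₃
  have hle₁ : min (min t₁ t₂) t₃ ≤ t₁ := (min_le_left _ _).trans (min_le_left _ _)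
  have hle₂ : min (min t₁ t₂) t₃ ≤ t₂ := (min_le_left _ _).trans (min_le_right _ _)
  rw [v.value_mix_eq hδ hxy h₂ ht₁ hU s ht hle₁, v.value_mix_eq hδ hxy h₂ ht₂ hU' s' ht hle₂]
  exact hO _ (hO' _ (min_le_right _ _)) _ _ _

lemma exists_segmentTransport : ∃ g : W Δ₁ →ₗ[F] W Δ₂,
    ∀ {U : Opens K.space} (s : A.presheaf.obj (op U)) (hx : x ∈ U) {t₁ : unitInterval}
      (ht₁ : 0 < t₁) (hU : ∀ t ≤ t₁, mix x y hxy t ∈ U),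
        v.value (hU t₁ le_rfl) ((pole_mix hδ hxy ht₁).trans h₂) s = g (v.value hx h₁ s) := by
  have hexists (a : W Δ₁) : ∃ b : W Δ₂, ∀ {U : Opens K.space} (s : A.presheaf.obj (op U))
      (hx : x ∈ U) {t₁ : unitInterval} (ht₁ : 0 < t₁) (hU : ∀ t ≤ t₁, mix x y hxy t ∈ U),
      v.value hx h₁ s = a → v.value (hU t₁ le_rfl) ((pole_mix hδ hxy ht₁).trans h₂) s = b := by
    obtain ⟨U₀, hx₀, s₀, e₀⟩ := v.exists_value_eq h₁ a
    obtain ⟨t₀, ht₀, hU₀⟩ := exists_pos_forall_mix_mem hx₀ hxy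
    exact ⟨_, fun s hx _ ht₁ hU e ↦ v.value_mix_eq_of_value_eq hδ hxy h₁ h₂ hx hx₀
      (e.trans e₀.symm) ht₁ ht₀ hU hU₀⟩
  choose g hg using hexists
  refine ⟨⟨⟨g, fun a b ↦ ?_⟩, fun r a ↦ ?_⟩, fun s hx _ ht₁ hU ↦ hg _ s hx ht₁ hU rfl⟩
  · obtain ⟨U, hx, s, s', rfl, rfl⟩ := v.exists_value_eq₂ h₁ a b
    obtain ⟨t, ht, hU⟩ := exists_pos_forall_mix_mem hx hxy
    rw [← hg _ s hx ht hU rfl, ← hg _ s' hx ht hU rfl]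
    exact (hg _ (s + s') hx ht hU (map_add _ _ _)).symm.trans (map_add _ _ _)
  · obtain ⟨U, hx, s, rfl⟩ := v.exists_value_eq h₁ a
    obtain ⟨t, ht, hU⟩ := exists_pos_forall_mix_mem hx hxy
    change g (r • v.value hx h₁ s) = r • g (v.value hx h₁ s)
    rw [← hg _ s hx ht hU rfl]
    exact (hg _ (r • s) hx ht hU (map_smul _ _ _)).symm.trans (map_smul _ _ _)

/-- The map that takes the value at `x` of a section defined near `x` to its value on an initial
part of the half-open segment from `x` to `y`. -/
def segmentTransport : W Δ₁ →ₗ[F] W Δ₂ := (v.exists_segmentTransport hδ hxy h₁ h₂).choose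

variable {U : Opens K.space}

lemma value_mix (hx : x ∈ U) {t₁ : unitInterval} (ht₁ : 0 < t₁)
    (hU : ∀ t ≤ t₁, mix x y hxy t ∈ U) (s : A.presheaf.obj (op U)) :
    v.value (hU t₁ le_rfl) ((pole_mix hδ hxy ht₁).trans h₂) s =
      v.segmentTransport hδ hxy h₁ h₂ (v.value hx h₁ s) :=
  (v.exists_segmentTransport hδ hxy h₁ h₂).choose_spec s hx ht₁ hU

lemma value_eq_segmentTransport (hx : x ∈ U) (hy : y ∈ U) (hU : ∀ t, mix x y hxy t ∈ U)
    (s : A.presheaf.obj (op U)) :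
    v.value hy h₂ s = v.segmentTransport hδ hxy h₁ h₂ (v.value hx h₁ s) := by
  rw [← v.value_mix hδ hxy h₁ h₂ hx zero_lt_one (fun t _ ↦ hU t)]
  exact v.value_congr (mix_one hxy).symm _ _ _ _ _

lemma segmentTransport_congr {x' y' : K.space} (ex : x = x') (ey : y = y')
    (hxy' : carrier x' ⊆ carrier y') (h₁' : pole δ x' = Δ₁) (h₂' : pole δ y' = Δ₂) :
    v.segmentTransport hδ hxy h₁ h₂ = v.segmentTransport hδ hxy' h₁' h₂' := by
  subst ex ey
  rfl

end SegmentTransport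

section Homotopy

variable {Y : Type*} [TopologicalSpace Y] {f g : Y → K.space} (hf : Continuous f)
  (hg : Continuous g) (hfg : ∀ r, carrier (f r) ⊆ carrier (g r))
include hf hg

lemma exists_pos_eventually_forall_mix_mem {U : Opens K.space} {r : Y} (hr : f r ∈ U) :
    ∃ t₁ : unitInterval, 0 < t₁ ∧ ∀ᶠ r' in 𝓝 r, ∀ t ≤ t₁, mix (f r') (g r') (hfg r') t ∈ U := by
  have hcont : Continuous fun p : Y × unitInterval ↦ mix (f p.1) (g p.1) (hfg p.1) p.2 :=
    continuous_mix _ (hf.comp continuous_fst) (hg.comp continuous_fst) continuous_snd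
  have hev : ∀ᶠ p : Y × unitInterval in 𝓝 (r, 0), mix (f p.1) (g p.1) (hfg p.1) p.2 ∈ U :=
    hcont.continuousAt.eventually (U.2.mem_nhds <| by
      change mix (f r) (g r) (hfg r) 0 ∈ U
      rwa [mix_zero])
  rw [nhds_prod_eq, Filter.eventually_prod_iff] at hev
  obtain ⟨P, hP, Q, hQ, hPQ⟩ := hev
  obtain ⟨t₁, ht₁, hQ'⟩ := exists_pos_forall_le hQ
  exact ⟨t₁, ht₁, hP.mono fun r' hr' t ht ↦ hPQ hr' (hQ' t ht)⟩

lemma segmentTransport_eq_of_preconnectedSpace [PreconnectedSpace Y] {Δ₁ Δ₂ : K.Simplex}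
    (h₁ : ∀ r, pole δ (f r) = Δ₁) (h₂ : ∀ r, pole δ (g r) = Δ₂) (r r' : Y) :
    v.segmentTransport hδ (hfg r) (h₁ r) (h₂ r) =
      v.segmentTransport hδ (hfg r') (h₁ r') (h₂ r') := by
  ext a
  refine IsLocallyConstant.apply_eq_of_preconnectedSpace
    (f := fun r ↦ v.segmentTransport hδ (hfg r) (h₁ r) (h₂ r) a) ?_ r r'
  rw [IsLocallyConstant.iff_eventually_eq]
  intro r
  obtain ⟨U, hr, s, rfl⟩ := v.exists_value_eq (h₁ r) a
  obtain ⟨t₁, ht₁, hU⟩ := exists_pos_eventually_forall_mix_mem hf hg hfg hr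
  have hp (r' : Y) : pole δ (mix (f r') (g r') (hfg r') t₁) = Δ₂ :=
    (pole_mix hδ _ ht₁).trans (h₂ r')
  have hcont : Continuous fun r' ↦ mix (f r') (g r') (hfg r') t₁ :=
    continuous_mix _ hf hg continuous_const
  filter_upwards [hU, hf.continuousAt.eventually (U.2.mem_nhds hr),
    hf.continuousAt.eventually (v.eventually_value_eq hr (h₁ r) s),
    hcont.continuousAt.eventually (v.eventually_value_eq (hU.self_of_nhds t₁ le_rfl) (hp r) s)]
    with r' hU' hr' hstart hend
  calc v.segmentTransport hδ (hfg r') (h₁ r') (h₂ r') (v.value hr (h₁ r) s)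
      = v.segmentTransport hδ (hfg r') (h₁ r') (h₂ r') (v.value hr' (h₁ r') s) := by
        rw [hstart hr' (h₁ r')]
    _ = v.value (hU' t₁ le_rfl) (hp r') s := (v.value_mix hδ _ _ (h₂ r') hr' ht₁ hU' s).symm
    _ = v.value (hU.self_of_nhds t₁ le_rfl) (hp r) s := hend _ _
    _ = v.segmentTransport hδ (hfg r) (h₁ r) (h₂ r) (v.value hr (h₁ r) s) :=
        v.value_mix hδ _ _ (h₂ r) hr ht₁ hU.self_of_nhds s

end Homotopy

section Transport

variable {Δ₁ Δ₂ : K.Simplex} (hi : Δ₁.Incident Δ₂) (hr : δ Δ₂.dim ≤ δ Δ₁.dim)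

/-- The map from the stalk at the stratum of `Δ₁` to the stalk at the adjacent stratum of `Δ₂`
given by the extension of sections, computed along the segment joining the barycenters. -/
def transport : W Δ₁ →ₗ[F] W Δ₂ :=
  v.segmentTransport hδ (carrier_center_subset_pairCenter hi) (pole_center hδ Δ₁)
    (pole_pairCenter hδ hi hr)

/- A segment between the strata is contracted to the one joining the barycenters by moving its
endpoints linearly; the endpoints stay inside their strata. -/
lemma segmentTransport_eq_transport {x y : K.space} (hxy : carrier x ⊆ carrier y)
    (h₁ : pole δ x = Δ₁) (h₂ : pole δ y = Δ₂) :
    v.segmentTransport hδ hxy h₁ h₂ = v.transport hδ hi hr := by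
  have m₁ : Δ₁ ∈ carrier x := h₁ ▸ pole_mem δ x
  have m₂ : Δ₂ ∈ carrier y := h₂ ▸ pole_mem δ y
  have hx := carrier_center_subset m₁
  have hy := carrier_pairCenter_subset hi (hxy m₁) m₂
  have hfg := carrier_mix_subset_carrier_mix (carrier_center_subset_pairCenter hi) hx hy hxy
  have hf := pole_mix_eq hδ hx (pole_center hδ Δ₁) h₁
  have hg := pole_mix_eq hδ hy (pole_pairCenter hδ hi hr) h₂
  calc v.segmentTransport hδ hxy h₁ h₂
      = v.segmentTransport hδ (hfg 1) (hf 1) (hg 1) :=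
        v.segmentTransport_congr hδ _ _ _ (mix_one hx).symm (mix_one hy).symm _ _ _
    _ = v.segmentTransport hδ (hfg 0) (hf 0) (hg 0) :=
        v.segmentTransport_eq_of_preconnectedSpace hδ (continuous_mix_segment hx)
          (continuous_mix_segment hy) hfg hf hg 1 0
    _ = v.transport hδ hi hr :=
        v.segmentTransport_congr hδ _ _ _ (mix_zero hx) (mix_zero hy) _ _ _

variable {U : Opens K.space} {x : K.space} (hx : x ∈ U) (h₁ : pole δ x = Δ₁)

lemma value_eq_transport {y : K.space} (hxy : carrier x ⊆ carrier y) (hy : y ∈ U)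
    (h₂ : pole δ y = Δ₂) (hU : ∀ t, mix x y hxy t ∈ U) (s : A.presheaf.obj (op U)) :
    v.value hy h₂ s = v.transport hδ hi hr (v.value hx h₁ s) := by
  rw [v.value_eq_segmentTransport hδ hxy h₁ h₂ hx hy hU,
    v.segmentTransport_eq_transport hδ hi hr]

lemma eventually_value_eq_transport (s : A.presheaf.obj (op U)) :
    ∀ᶠ y in 𝓝 x, ∀ (hy : y ∈ U) (h₂ : pole δ y = Δ₂),
      v.value hy h₂ s = v.transport hδ hi hr (v.value hx h₁ s) := by
  obtain ⟨ε, hε, hball⟩ := Metric.mem_nhds_iff.mp (U.2.mem_nhds hx)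
  filter_upwards [eventually_carrier_subset x, Metric.ball_mem_nhds x hε] with y hxy hyε hy h₂
  exact v.value_eq_transport hδ hi hr hx h₁ hxy hy h₂
    (fun t ↦ hball ((dist_mix_le hxy t).trans_lt hyε)) s

end Transport

lemma transport_self {Δ : K.Simplex} (hi : Δ.Incident Δ) (hr : δ Δ.dim ≤ δ Δ.dim) (a : W Δ) :
    v.transport hδ hi hr a = a := by
  obtain ⟨U, hx, s, rfl⟩ := v.exists_value_eq (pole_center hδ Δ) a
  exact ((v.eventually_value_eq_transport hδ hi hr hx (pole_center hδ Δ) s).self_of_nhds hx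
    (pole_center hδ Δ)).symm

/- A section defined near `center Δ₁` is evaluated at a nearby point of the stratum of `Δ₂`, and
at a point of the stratum of `Δ₃` near both. -/
lemma transport_transport {Δ₁ Δ₂ Δ₃ : K.Simplex} (h₁₂ : Δ₁.Incident Δ₂) (h₂₃ : Δ₂.Incident Δ₃)
    (h₁₃ : Δ₁.Incident Δ₃) (r₁₂ : δ Δ₂.dim ≤ δ Δ₁.dim) (r₂₃ : δ Δ₃.dim ≤ δ Δ₂.dim) (a : W Δ₁) :
    v.transport hδ h₂₃ r₂₃ (v.transport hδ h₁₂ r₁₂ a) =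
      v.transport hδ h₁₃ (r₂₃.trans r₁₂) a := by
  obtain ⟨z, hz⟩ := exists_carrier_eq (isFlag_triple h₁₂ h₂₃ h₁₃)
  have hpz : pole δ z = Δ₃ := by simp [pole_eq_iff hδ, hz, r₂₃, r₂₃.trans r₁₂]
  have hc := carrier_center_subset_pairCenter h₁₂
  have hcz (t) (ht : 0 < t) : carrier (mix _ _ hc t) ⊆ carrier z := by
    rw [carrier_mix hc ht]
    exact carrier_pairCenter_subset h₁₂ (by simp [hz]) (by simp [hz])
  obtain ⟨U, hx, s, rfl⟩ := v.exists_value_eq (pole_center hδ Δ₁) a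
  obtain ⟨t, ht, hnear⟩ := exists_pos_forall_le <|
    (eventually_mix_mem hc hx).and <| (continuous_mix_segment hc).continuousAt.eventually <| by
      rw [mix_zero]
      exact (v.eventually_value_eq_transport hδ h₁₂ r₁₂ hx (pole_center hδ Δ₁) s).and
        (v.eventually_value_eq_transport hδ h₁₃ (r₂₃.trans r₁₂) hx
          (pole_center hδ Δ₁) s).eventually_nhds
  obtain ⟨hy, hs₂, hs₃⟩ := hnear t le_rfl
  have hpy := (pole_mix hδ hc ht).trans (pole_pairCenter hδ h₁₂ r₁₂)
  obtain ⟨t', ht', hnear'⟩ := exists_pos_forall_le <|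
    (eventually_mix_mem (hcz t ht) hy).and <|
      (continuous_mix_segment (hcz t ht)).continuousAt.eventually <| by
        rw [mix_zero]
        exact hs₃
  have hpw := (pole_mix hδ (hcz t ht) ht').trans hpz
  rw [← hs₂ hy hpy, ← (hnear' t' le_rfl).2 (hnear' t' le_rfl).1 hpw]
  rw [v.value_mix hδ (hcz t ht) hpy hpz hy ht' (fun t ht ↦ (hnear' t ht).1),
    v.segmentTransport_eq_transport hδ h₂₃ r₂₃]

end StratumValues

end PerverseSheaves

end

noncomputable section

namespace PerverseSheaves

open AbstractSimplicialComplex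

open Topology

variable {F : Type u} [Field F] {V : Type u} [Fintype V] {K : AbstractSimplicialComplex V}
  {δ : ℕ → ℤ} {S T : LinearData F K δ}

/-! ### The sheaf of linear algebra data -/

section SheafOf

/-- The pairs of an element of the stalk of `S` at the pole of `x` and its image under the map
along a path to the pole of `y`; no condition if there is no path. -/
def pathRelation (S : LinearData F K δ) (x y : K.space) :
    Submodule F (S.stalk (pole δ x) × S.stalk (pole δ y)) where
  carrier := {a | ∀ h : K.PathLE δ (pole δ x) (pole δ y), a.2 = pathMap S h a.1}
  zero_mem' h := (map_zero (pathMap S h).hom).symm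
  add_mem' {a b} ha hb h := by rw [Prod.snd_add, Prod.fst_add, ha h, hb h, map_add]
  smul_mem' r a ha h := by rw [Prod.smul_snd, Prod.smul_fst, ha h, map_smul]

/-- The sheaf whose sections are the families of elements of the stalks of `S` that are locally
compatible with the maps along paths. -/
abbrev sheafOf (S : LinearData F K δ) : TopCat.Sheaf (ModuleCat.{u} F) K.space :=
  localSections (fun x ↦ S.stalk (pole δ x)) (pathRelation S)

variable (hδ : IsPerversity δ)

section Elementwise

include hδ

omit [Fintype V] in
lemma pathMap_pathMap {Δ Δ' Δ'' : K.Simplex} (h : K.PathLE δ Δ Δ') (h' : K.PathLE δ Δ' Δ'')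
    (h'' : K.PathLE δ Δ Δ'') (m : S.stalk Δ) :
    pathMap S h' (pathMap S h m) = pathMap S h'' m :=
  congr($(pathMap_comp hδ S h h' h'') m)

omit [Fintype V] in
lemma pathMap_self {Δ : K.Simplex} (h : K.PathLE δ Δ Δ) (m : S.stalk Δ) : pathMap S h m = m :=
  congr($(pathMap_refl hδ S h) m)

omit [Fintype V] in
lemma app_pathMap (α : S ⟶ T) {Δ Δ' : K.Simplex} (h : K.PathLE δ Δ Δ') (m : S.stalk Δ) :
    LinearData.Hom.app α Δ' (pathMap S h m) = pathMap T h (LinearData.Hom.app α Δ m) :=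
  congr($(pathMap_naturality hδ α h) m)

lemma mem_perverseStar_pole (x : K.space) : x ∈ K.perverseStar δ (pole δ x) :=
  (mem_perverseStar_iff hδ).mpr .refl

lemma center_mem_perverseStar {Δ Δ' : K.Simplex} (h : K.PathLE δ Δ Δ') :
    center Δ' ∈ K.perverseStar δ Δ := by
  rwa [mem_perverseStar_iff hδ, pole_center hδ]

end Elementwise

/-- The section of `sheafOf S` on the perverse star of `Δ` spread out from an element of the stalk
of `S` at `Δ`. -/
def starSection (Δ : K.Simplex) : S.stalk Δ →ₗ[F]
    localSectionsSubmodule (fun x ↦ S.stalk (pole δ x)) (pathRelation S) (K.perverseStar δ Δ) where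
  toFun m := ⟨fun x ↦ pathMap S ((mem_perverseStar_iff hδ).mp x.2) m, fun _ ↦
    .of_forall fun _ _ h ↦ (pathMap_pathMap hδ _ h _ m).symm⟩
  map_add' _ _ := Subtype.ext (funext fun _ ↦ map_add _ _ _)
  map_smul' _ _ := Subtype.ext (funext fun _ ↦ map_smul _ _ _)

include hδ in
lemma stalkEval_bijective (S : LinearData F K δ) (x : K.space) :
    Function.Bijective (stalkEval (fun x ↦ S.stalk (pole δ x)) (pathRelation S) x) := by
  refine ⟨stalkEval_injective ?_, stalkEval_surjective fun m ↦
    ⟨_, mem_perverseStar_pole hδ x, starSection hδ _ m, pathMap_self hδ _ m⟩⟩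
  filter_upwards [eventually_pathLE_pole hδ x] with y h b hb
  exact (hb h).trans (map_zero (pathMap S h).hom)

lemma germ_eq_germ_starSection {U : Opens K.space} {x : K.space} (hx : x ∈ U)
    (s : (sheafOf S).presheaf.obj (op U)) :
    (sheafOf S).presheaf.germ U x hx s =
      (sheafOf S).presheaf.germ (K.perverseStar δ (pole δ x)) x (mem_perverseStar_pole hδ x)
        (starSection hδ (pole δ x) (s.1 ⟨x, hx⟩)) := by
  apply (stalkEval_bijective hδ S x).1
  exact (stalkEval_germ hx s).trans <|
    (pathMap_self hδ .refl _).symm.trans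
      (stalkEval_germ (C := pathRelation S) (mem_perverseStar_pole hδ x) (starSection hδ _ _)).symm

/-- The stalk of `sheafOf S` at a point of the stratum of `Δ`. -/
def stalkEquiv (S : LinearData F K δ) {Δ : K.Simplex} {x : K.space} (h : pole δ x = Δ) :
    (sheafOf S).presheaf.stalk x ≃ₗ[F] S.stalk Δ :=
  h ▸ LinearEquiv.ofBijective (stalkEval _ _ x).hom (stalkEval_bijective hδ S x)

lemma stalkEquiv_germ {Δ : K.Simplex} {x : K.space} (h : pole δ x = Δ)
    (h' : K.PathLE δ (pole δ x) Δ) {U : Opens K.space} (hx : x ∈ U)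
    (s : (sheafOf S).presheaf.obj (op U)) :
    stalkEquiv hδ S h ((sheafOf S).presheaf.germ U x hx s) = pathMap S h' (s.1 ⟨x, hx⟩) := by
  subst h
  exact (stalkEval_germ hx s).trans (pathMap_self hδ h' _).symm

/-- The sheaf of `S` is locally constant along each stratum, with the stalks of `S` as values. -/
def sheafOfValues (S : LinearData F K δ) : StratumValues δ (sheafOf S) S.stalk where
  val h := stalkEquiv hδ S h
  eventually_eq {U} s {Δ x} hx h := by
    filter_upwards [s.2 ⟨x, hx⟩] with y hy hyU h'
    have hxy : K.PathLE δ (pole δ x) (pole δ y) := h'.symm ▸ h ▸ .refl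
    have hyΔ : K.PathLE δ (pole δ y) Δ := h' ▸ .refl
    exact (stalkEquiv_germ hδ h' hyΔ hyU s).trans <|
      (congrArg (pathMap S hyΔ) (hy hyU hxy)).trans <|
      (pathMap_pathMap hδ hxy hyΔ (hxy.trans hyΔ) _).trans
        (stalkEquiv_germ hδ h (hxy.trans hyΔ) hx s).symm

end SheafOf

/-! ### Sections on perverse stars -/

section StarSections

variable (hδ : IsPerversity δ)

lemma sheafOfValues_value_starSection {Δ Δ' : K.Simplex} (h : K.PathLE δ Δ Δ') {x : K.space}
    (hx : x ∈ K.perverseStar δ Δ) (hΔ' : pole δ x = Δ') (m : S.stalk Δ) :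
    (sheafOfValues hδ S).value hx hΔ' (starSection hδ Δ m) = pathMap S h m := by
  subst hΔ'
  exact stalkEval_germ hx _

lemma sheafOfValues_value_center_starSection {Δ : K.Simplex} (hc : center Δ ∈ K.perverseStar δ Δ)
    (m : S.stalk Δ) :
    (sheafOfValues hδ S).value hc (pole_center hδ Δ) (starSection hδ Δ m) = m :=
  (sheafOfValues_value_starSection hδ .refl hc _ m).trans (pathMap_self hδ _ m)

lemma sheafOfValues_transport {Δ Δ' : K.Simplex} (hi : Δ.Incident Δ')
    (hr : δ Δ'.dim ≤ δ Δ.dim) (h : K.PathLE δ Δ Δ') (m : S.stalk Δ) :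
    (sheafOfValues hδ S).transport hδ hi hr m = pathMap S h m := by
  have hc := center_mem_perverseStar hδ (.refl : K.PathLE δ Δ Δ)
  have hmix := mix_mem_perverseStar hδ (carrier_center_subset_pairCenter hi) hc
  have hp : pairCenter hi ∈ K.perverseStar δ Δ := by simpa only [mix_one] using hmix 1
  calc (sheafOfValues hδ S).transport hδ hi hr m
      = (sheafOfValues hδ S).transport hδ hi hr
          ((sheafOfValues hδ S).value hc (pole_center hδ Δ) (starSection hδ Δ m)) :=
        congrArg _ (sheafOfValues_value_center_starSection hδ hc m).symm
    _ = (sheafOfValues hδ S).value hp (pole_pairCenter hδ hi hr) (starSection hδ Δ m) :=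
        ((sheafOfValues hδ S).value_eq_transport hδ hi hr hc _ _ hp _ hmix _).symm
    _ = pathMap S h m := sheafOfValues_value_starSection hδ h hp _ m

variable {Δ Δ' : K.Simplex} (s : (sheafOf S).presheaf.obj (op (K.perverseStar δ Δ)))

lemma value_eq_value_center (h : K.PathLE δ Δ Δ') {x : K.space} (hx : x ∈ K.perverseStar δ Δ)
    (hΔ' : pole δ x = Δ') :
    (sheafOfValues hδ S).value hx hΔ' s = (sheafOfValues hδ S).value
      (center_mem_perverseStar hδ h) (pole_center hδ Δ') s := by
  have hc := carrier_center_subset (hΔ' ▸ pole_mem δ x)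
  have hi : Δ'.Incident Δ' := Or.inl subset_rfl
  have hc' := center_mem_perverseStar hδ h
  exact ((sheafOfValues hδ S).value_eq_transport hδ hi le_rfl hc' _ hc hx hΔ'
    (mix_mem_perverseStar hδ hc hc') s).trans ((sheafOfValues hδ S).transport_self hδ hi _ _)

lemma value_eq_pathMap_value_center (h : K.PathLE δ Δ Δ') {x : K.space}
    (hx : x ∈ K.perverseStar δ Δ) (hΔ' : pole δ x = Δ') :
    (sheafOfValues hδ S).value hx hΔ' s = pathMap S h ((sheafOfValues hδ S).value
      (center_mem_perverseStar hδ .refl) (pole_center hδ Δ) s) := by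
  induction h generalizing x with
  | refl => exact (value_eq_value_center hδ s .refl hx hΔ').trans (pathMap_self hδ _ _).symm
  | @tail D D' path arrow ih =>
    have hr : δ D'.dim ≤ δ D.dim := rank_le_of_pathLE (.single arrow)
    have hD := center_mem_perverseStar hδ path
    have hmix := mix_mem_perverseStar hδ (carrier_center_subset_pairCenter arrow.2) hD
    have hp : pairCenter arrow.2 ∈ K.perverseStar δ Δ := by simpa only [mix_one] using hmix 1
    let v := sheafOfValues hδ S
    calc v.value hx hΔ' s
        = v.value (center_mem_perverseStar hδ (path.tail arrow)) (pole_center hδ D') s :=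
          value_eq_value_center hδ s (path.tail arrow) hx hΔ'
      _ = v.value hp (pole_pairCenter hδ arrow.2 hr) s :=
          (value_eq_value_center hδ s (path.tail arrow) hp _).symm
      _ = v.transport hδ arrow.2 hr (v.value hD (pole_center hδ D) s) :=
          v.value_eq_transport hδ arrow.2 hr hD _ _ hp _ hmix s
      _ = pathMap S (.single arrow) (v.value hD (pole_center hδ D) s) :=
          sheafOfValues_transport hδ arrow.2 hr _ _
      _ = _ := (congrArg _ (ih hD _)).trans (pathMap_pathMap hδ _ _ _ _)

lemma starSection_bijective (S : LinearData F K δ) (Δ : K.Simplex) :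
    Function.Bijective (starSection (S := S) hδ Δ) := by
  have hc := center_mem_perverseStar hδ (.refl : K.PathLE δ Δ Δ)
  refine ⟨fun m n h ↦ ?_, fun s ↦
    ⟨(sheafOfValues hδ S).value hc (pole_center hδ Δ) s, Subtype.ext (funext fun x ↦ ?_)⟩⟩
  · exact (sheafOfValues_value_center_starSection hδ hc m).symm.trans <|
      (congrArg _ h).trans (sheafOfValues_value_center_starSection hδ hc n)
  · exact (value_eq_pathMap_value_center hδ s _ x.2 rfl).symm.trans <|
      stalkEval_germ (C := pathRelation S) x.2 s

end StarSections

/-! ### The functor from linear algebra data to sheaves -/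

section Functor

variable (hδ : IsPerversity δ)

/-- The map on sections induced by a morphism of linear algebra data. -/
def sheafOfMapApp (α : S ⟶ T) (U : Opens K.space) :
    localSectionsSubmodule (fun x ↦ S.stalk (pole δ x)) (pathRelation S) U →ₗ[F]
      localSectionsSubmodule (fun x ↦ T.stalk (pole δ x)) (pathRelation T) U where
  toFun s := ⟨fun x ↦ LinearData.Hom.app α _ (s.1 x), fun x ↦ by
    filter_upwards [s.2 x] with y hs hy h
    exact (congrArg (LinearData.Hom.app α _) (hs hy h)).trans (app_pathMap hδ α h _)⟩
  map_add' _ _ := Subtype.ext (funext fun _ ↦ map_add _ _ _)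
  map_smul' _ _ := Subtype.ext (funext fun _ ↦ map_smul _ _ _)

variable (F K) in
/-- The functor sending linear algebra data to their sheaf. -/
def sheafOfFunctor : LinearData F K δ ⥤ TopCat.Sheaf (ModuleCat.{u} F) K.space where
  obj S := sheafOf S
  map α :=
    ⟨{ app := fun U ↦ ModuleCat.ofHom (sheafOfMapApp hδ α U.unop)
       naturality := fun _ _ _ ↦ rfl }⟩
  map_id _ := rfl
  map_comp _ _ := rfl

/-- The canonical morphism from linear algebra data to the sections of their sheaf over the
perverse stars. -/
def starHom (S : LinearData F K δ) : S ⟶ (K.sheafData F δ).obj (sheafOf S) where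
  app Δ := ModuleCat.ofHom (starSection hδ Δ)
  comm {Δ Δ'} arrow := ModuleCat.hom_ext <| LinearMap.ext fun m ↦
    Subtype.ext <| funext fun x ↦ by
      change pathMap S _ (S.res arrow m) = pathMap S _ m
      rw [← pathMap_of_hasArrow hδ S arrow (.single arrow)]
      exact pathMap_pathMap hδ _ _ _ m

variable (F K) in
/-- Linear algebra data are recovered as the sections of their sheaf over the perverse stars. -/
def sheafOfCompSheafDataIso :
    𝟭 (LinearData F K δ) ≅ sheafOfFunctor F K hδ ⋙ K.sheafData F δ :=
  NatIso.ofComponents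
    (fun S ↦ linearDataIsoOfBijective (starHom hδ S) (starSection_bijective hδ S))
    fun α ↦ LinearData.Hom.ext <| funext fun _ ↦ ModuleCat.hom_ext <| LinearMap.ext fun m ↦
      Subtype.ext <| funext fun _ ↦ (app_pathMap hδ α _ m).symm

lemma app_apply_eq_app_starSection (f : sheafOf S ⟶ sheafOf T) {U : Opens K.space} (x : U)
    (s : (sheafOf S).presheaf.obj (op U)) :
    (f.hom.app (op U) s).1 x =
      (f.hom.app (op (K.perverseStar δ (pole δ x.1)))
        (starSection hδ (pole δ x.1) (s.1 x))).1 ⟨x, mem_perverseStar_pole hδ x.1⟩ := by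
  have happ {W : Opens K.space} (hx : x.1 ∈ W) (t : (sheafOf S).presheaf.obj (op W)) :
      (f.hom.app (op W) t).1 ⟨x, hx⟩ = stalkEval _ _ x.1
        (stalkHom f.hom x.1 ((sheafOf S).presheaf.germ W x hx t)) :=
    (stalkEval_germ hx _).symm.trans
      (congrArg (stalkEval _ _ x.1) congr($(germ_stalkHom f.hom hx) t)).symm
  exact (happ x.2 s).trans <| (congrArg (fun a ↦ stalkEval _ _ x.1 (stalkHom f.hom x.1 a))
    (germ_eq_germ_starSection hδ x.2 s)).trans (happ (mem_perverseStar_pole hδ x.1) _).symm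

include hδ in
lemma sheafData_map_injective {f g : sheafOf S ⟶ sheafOf T}
    (h : (K.sheafData F δ).map f = (K.sheafData F δ).map g) : f = g := by
  refine CategoryTheory.Sheaf.hom_ext <| NatTrans.ext <| funext fun U ↦ ModuleCat.hom_ext <|
    LinearMap.ext fun s ↦ Subtype.ext <| funext fun x ↦ ?_
  have hstar : f.hom.app (op (K.perverseStar δ (pole δ x.1))) =
      g.hom.app (op (K.perverseStar δ (pole δ x.1))) :=
    congrFun (congrArg LinearData.Hom.app h) _
  exact (app_apply_eq_app_starSection hδ f x s).trans <|
    (congr(($hstar _).1 _)).trans (app_apply_eq_app_starSection hδ g x s).symm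

instance sheafOfFunctor_faithful : (sheafOfFunctor F K hδ).Faithful :=
  Functor.Faithful.of_comp_iso (sheafOfCompSheafDataIso F K hδ).symm

instance sheafOfFunctor_full : (sheafOfFunctor F K hδ).Full where
  map_surjective {S T} f := by
    let e := sheafOfCompSheafDataIso F K hδ
    let α : S ⟶ T := e.hom.app S ≫ (K.sheafData F δ).map f ≫ e.inv.app T
    refine ⟨α, sheafData_map_injective hδ ?_⟩
    have h := e.hom.naturality α
    have h' : α ≫ e.hom.app T = e.hom.app S ≫ (K.sheafData F δ).map f := by
      refine (Category.assoc _ _ _).trans (congrArg (e.hom.app S ≫ ·) ?_)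
      exact (Category.assoc _ _ _).trans <|
        (congrArg ((K.sheafData F δ).map f ≫ ·) (e.inv_hom_id_app T)).trans (Category.comp_id _)
    exact (cancel_epi (e.hom.app S)).mp (h.symm.trans h')

include hδ in
lemma isPerverselyConstructible_sheafOf (S : K.FinLinearData F δ) :
    K.IsPerverselyConstructible F (fun k ↦ -δ k) (sheafOf S.obj) :=
  (isPerverselyConstructible_iff hδ _).mpr
    ⟨S.obj.stalk, S.property, ⟨sheafOfValues hδ S.obj⟩⟩

variable (F K) in
/-- The functor from finite-dimensional linear algebra data to constructible sheaves. -/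
def finSheafOf : K.FinLinearData F δ ⥤ K.DeltaSheaf F δ :=
  ObjectProperty.lift _ (ObjectProperty.ι _ ⋙ sheafOfFunctor F K hδ)
    (isPerverselyConstructible_sheafOf hδ)

instance finSheafOf_faithful : (finSheafOf F K hδ).Faithful :=
  Functor.Faithful.of_comp_iso (H := ObjectProperty.ι _ ⋙ sheafOfFunctor F K hδ)
    (ObjectProperty.liftCompιIso _ _ _)

instance finSheafOf_full : (finSheafOf F K hδ).Full :=
  Functor.Full.of_comp_faithful_iso (H := ObjectProperty.ι _ ⋙ sheafOfFunctor F K hδ)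
    (ObjectProperty.liftCompιIso _ _ _)

end Functor

end PerverseSheaves

end

noncomputable section

namespace PerverseSheaves

open AbstractSimplicialComplex

open Topology

variable {F : Type u} [Field F] {V : Type u} [Fintype V] {K : AbstractSimplicialComplex V}
  {δ : ℕ → ℤ}

/-! ### The linear algebra data of a constructible sheaf -/

namespace StratumValues

variable {A : TopCat.Sheaf (ModuleCat.{u} F) K.space} {W : K.Simplex → ModuleCat.{u} F}
  (v : StratumValues δ A W) (hδ : IsPerversity δ)

/-- The linear algebra data given by the transport between the strata. -/
def linearData : LinearData F K δ where
  stalk := W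
  res arrow := ModuleCat.ofHom (v.transport hδ arrow.2 (rank_le_of_pathLE (.single arrow)))
  equivalence {Δ' Δ₁ Δ₂ Δ''} h₁ h₁' h₂ h₂' := by
    obtain rfl | hne := eq_or_ne Δ₁ Δ₂
    · rfl
    have hi := incident_of_two_paths hδ h₁ h₁' h₂ h₂' hne
    have hr {D D' : K.Simplex} (arrow : K.HasArrow δ D D') := rank_le_of_pathLE (.single arrow)
    exact ModuleCat.hom_ext <| LinearMap.ext fun a ↦
      (v.transport_transport hδ h₁.2 h₁'.2 hi (hr h₁) (hr h₁') a).trans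
        (v.transport_transport hδ h₂.2 h₂'.2 hi (hr h₂) (hr h₂') a).symm

lemma pathMap_linearData {Δ Δ' : K.Simplex} (hi : Δ.Incident Δ') (hr : δ Δ'.dim ≤ δ Δ.dim)
    (h : K.PathLE δ Δ Δ') (a : W Δ) :
    pathMap (v.linearData hδ) h a = v.transport hδ hi hr a := by
  obtain ⟨n, hn⟩ : ∃ n : ℕ, δ Δ.dim = δ Δ'.dim + n := ⟨(δ Δ.dim - δ Δ'.dim).toNat, by omega⟩
  induction n using Nat.strong_induction_on generalizing Δ Δ' with
  | _ n ih =>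
    obtain rfl | rfl | hn2 : n = 0 ∨ n = 1 ∨ 1 < n := by omega
    · obtain rfl := eq_of_pathLE_of_rank_eq h (by omega)
      exact (pathMap_self (S := v.linearData hδ) hδ h a).trans (v.transport_self hδ hi hr a).symm
    · have arrow : K.HasArrow δ Δ Δ' := ⟨by omega, hi⟩
      exact congr($(pathMap_of_hasArrow hδ (v.linearData hδ) arrow h) a)
    obtain ⟨D, hD, hD', hlt', hlt⟩ := exists_incident_between hδ hi (by omega)
    have path := pathLE_of_incident hδ hD hlt.le
    have path' := pathLE_of_incident hδ hD' hlt'.le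
    let S := v.linearData hδ
    have hpath : pathMap S path a = v.transport hδ hD hlt.le a :=
      ih (δ Δ.dim - δ D.dim).toNat (by omega) hD hlt.le path a (by omega)
    have hpath' (b : W D) : pathMap S path' b = v.transport hδ hD' hlt'.le b :=
      ih (δ D.dim - δ Δ'.dim).toNat (by omega) hD' hlt'.le path' b (by omega)
    exact (pathMap_pathMap (S := S) hδ path path' h a).symm.trans <|
      (congrArg (pathMap S path') hpath).trans <|
      (hpath' _).trans (v.transport_transport hδ hD hD' hi hlt.le hlt'.le a)

/-- The family of the values of a section of `A`, as a section of the sheaf of `v.linearData hδ`. -/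
def toSheafOfApp (U : Opens K.space) : A.presheaf.obj (op U) →ₗ[F]
    localSectionsSubmodule (fun x ↦ (v.linearData hδ).stalk (pole δ x))
      (pathRelation (v.linearData hδ)) U where
  toFun s := ⟨fun x ↦ v.value x.2 rfl s, fun x ↦ by
    filter_upwards [eventually_carrier_subset x.1, (Filter.eventually_all (ι := K.Simplex)).mpr
      fun Δ ↦ Filter.eventually_all.mpr fun hi : (pole δ x.1).Incident Δ ↦
        Filter.eventually_all.mpr fun hr ↦ v.eventually_value_eq_transport hδ hi hr x.2 rfl s]
      with y hxy hev hy h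
    have hi : (pole δ x.1).Incident (pole δ y) :=
      (isFlag_carrier y).2 _ (hxy (pole_mem δ x.1)) _ (pole_mem δ y)
    have hr := rank_le_of_pathLE h
    exact (hev _ hi hr hy rfl).trans (v.pathMap_linearData hδ hi hr h _).symm⟩
  map_add' _ _ := Subtype.ext (funext fun _ ↦ map_add _ _ _)
  map_smul' _ _ := Subtype.ext (funext fun _ ↦ map_smul _ _ _)

/-- The comparison of a constructible sheaf with the sheaf of its linear algebra data. -/
def toSheafOf : A ⟶ sheafOf (v.linearData hδ) :=
  ⟨{ app := fun U ↦ ModuleCat.ofHom (v.toSheafOfApp hδ U.unop)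
     naturality := fun _ _ i ↦ ModuleCat.hom_ext <| LinearMap.ext fun s ↦ Subtype.ext <|
      funext fun x ↦ v.value_map i.unop (leOfHom i.unop x.2) x.2 rfl s }⟩

lemma stalkHom_toSheafOf_bijective (x : K.space) :
    Function.Bijective (stalkHom (v.toSheafOf hδ).hom x) := by
  refine (Function.Bijective.of_comp_iff' (stalkEval_bijective hδ (v.linearData hδ) x) _).mp ?_
  have hval : stalkEval _ _ x ∘ stalkHom (v.toSheafOf hδ).hom x = v.val (x := x) rfl := by
    funext a
    obtain ⟨U, hx, s, rfl⟩ := A.presheaf.exists_germ_eq a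
    exact (congrArg (stalkEval _ _ x) congr($(germ_stalkHom (v.toSheafOf hδ).hom hx) s)).trans
      (stalkEval_germ (C := pathRelation (v.linearData hδ)) hx (v.toSheafOfApp hδ U s))
  rw [hval]
  exact (v.val rfl).bijective

instance isIso_toSheafOf : IsIso (v.toSheafOf hδ) := by
  have : ∀ x, IsIso ((TopCat.Presheaf.stalkFunctor (ModuleCat.{u} F) x).map
      (v.toSheafOf hδ).hom) := fun x ↦
    (ConcreteCategory.isIso_iff_bijective _).mpr (v.stalkHom_toSheafOf_bijective hδ x)
  exact TopCat.Presheaf.isIso_of_stalkFunctor_map_iso (v.toSheafOf hδ)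

end StratumValues

variable (hδ : IsPerversity δ)

instance finSheafOf_essSurj : (finSheafOf F K hδ).EssSurj where
  mem_essImage A := by
    obtain ⟨W, hW, ⟨v⟩⟩ := (isPerverselyConstructible_iff hδ A.obj).mp A.property
    exact ⟨⟨v.linearData hδ, hW⟩, ⟨ObjectProperty.isoMk _ (asIso (v.toSheafOf hδ)).symm⟩⟩

instance finSheafOf_isEquivalence : (finSheafOf F K hδ).IsEquivalence where

end PerverseSheaves

end

open PerverseSheaves AbstractSimplicialComplex in
theorem theoremB_general {F : Type u} [Field F] {V : Type u} [Fintype V]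
    (K : AbstractSimplicialComplex V) (δ : ℕ → ℤ) (hδ : IsPerversity δ) :
    (∃ E : K.CategoryR F δ ≌ K.DeltaSheaf F δ,
      Nonempty (E.functor ⋙ ObjectProperty.ι _ ⋙ K.sheafData F δ ≅
        ObjectProperty.ι _ ⋙ K.moduleData F δ)) ∧
    (∃ E' : K.CategoryR F δ ≌ K.FinLinearData F δ,
      Nonempty (E'.functor ⋙ ObjectProperty.ι _ ≅ ObjectProperty.ι _ ⋙ K.moduleData F δ)) := by
  let modulesToData := (finModuleData F K δ).asEquivalence
  let dataToSheaves := (finSheafOf F K hδ).asEquivalence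
  refine ⟨⟨modulesToData.trans dataToSheaves, ⟨?_⟩⟩, ⟨modulesToData, ⟨Iso.refl _⟩⟩⟩
  exact Functor.isoWhiskerLeft (ObjectProperty.ι _ ⋙ K.moduleData F δ)
    (sheafOfCompSheafDataIso F K hδ).symm

theorem theoremB {F : Type u} [Field F] [CharZero F] {V : Type u} [Fintype V]
    (K : AbstractSimplicialComplex V) (hK : ConnectedSpace K.space)
    (δ : ℕ → ℤ) (hδ : IsPerversity δ) :
    (∃ E : K.CategoryR F δ ≌ K.DeltaSheaf F δ,
      Nonempty (E.functor ⋙ ObjectProperty.ι _ ⋙ K.sheafData F δ ≅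
        ObjectProperty.ι _ ⋙ K.moduleData F δ)) ∧
    (∃ E' : K.CategoryR F δ ≌ K.FinLinearData F δ,
      Nonempty (E'.functor ⋙ ObjectProperty.ι _ ≅ ObjectProperty.ι _ ⋙ K.moduleData F δ)) :=
  theoremB_general K δ hδ
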